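/- \textbf{Proposition.} Let $\mathcal T$ be a triangulated category with translation $T$, let $\mathcal E$ be an abelian category, and let $H:\mathcal T\to\mathcal E$ be a bounded cohomological functor, i.e. an additive functor which turns every distinguished triangle $A\xrightarrow{a}B\xrightarrow{b}C\xrightarrow{c}TA$ into a long exact sequence $\cdots\to H(T^iA)\to H(T^iB)\to H(T^iC)\to H(T^{i+1}A)\to\cdots$, and such that for every object $A$ one has $H(T^iA)=0$ for all but finitely many $i\in\mathbb Z$. Let $\mathcal P$ be a (commutative) Picard category, i.e. a symmetric monoidal category in which all morphisms are isomorphisms and $X\mapsto W\otimes X$ is an autoequivalence for every object $W$; $\varphi$ and $\psi$ denote its associativity and commutativity constraints. \emph{Determinant functors.} A determinant functor $f=(f_1,f_2)$ on $\mathcal T$ with values in $\mathcal P$ consists of a functor $f_1$ from $\mathcal T_{\mathrm{iso}}$ (the objects and isomorphisms of $\mathcal T$) to $\mathcal P$ and, for every distinguished triangle $\Delta:A\to B\to C\to TA$, an isomorphism $f_2(\Delta):f_1(B)\to f_1(A)\otimes f_1(C)$, such that: (i) $f_2$ is natural for isomorphisms of distinguished triangles; (ii) for every octahedral diagram with horizontal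 distinguished triangles $\Delta_{h1}:A\to B\to C'\to TA$, $\Delta_{h2}:A\to C\to B'\to TA$ and vertical distinguished triangles $\Delta_{v1}:B\to C\to A'\to TB$, $\Delta_{v2}:C'\to B'\to A'\to TC'$ one has $$(f_2(\Delta_{h1})\otimes\mathrm{id})\circ f_2(\Delta_{v1})=\varphi_{f_1(A),f_1(C'),f_1(A')}\circ(\mathrm{id}\otimes f_2(\Delta_{v2}))\circ f_2(\Delta_{h2});$$ (iii) for the split triangles $\Delta_1:A\to A\oplus B\to B\xrightarrow{0}TA$ and $\Delta_2:B\to A\oplus B\to A\xrightarrow{0}TB$ one has $\psi_{f_1(A),f_1(B)}\circ f_2(\Delta_1)=f_2(\Delta_2)$. A morphism $f\to f'$ is a natural isomorphism $\lambda:f_1\to f_1'$ with $(\lambda_A\otimes\lambda_C)\circ f_2(\Delta)=f'_2(\Delta)\circ\lambda_B$ for all $\Delta$. This defines the category $\det(\mathcal T,\mathcal P)$. Let $\mathrm{Gr}^{\mathrm b}(\mathcal E)$ be the category of $\mathbb Z$-graded objects $(A_i)_{i\in\mathbb Z}$ of $\mathcal E$ with $A_i=0$ for all but finitely many $i$, with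 degreewise short exact sequences and translation $(TA)_j=A_{j+1}$. A unit in $\mathcal P$ is a pair $(U,\delta)$ with $\delta:U\to U\otimes U$ an isomorphism; a morphism of units $(U,\delta)\to(U',\delta')$ is a morphism $\alpha:U\to U'$ with $(\alpha\otimes\alpha)\circ\delta=\delta'\circ\alpha$; the product of $(U,\delta)$ and $(U',\delta')$ is $U\otimes U'$ with $U\otimes U'\xrightarrow{\delta\otimes\delta'}(U\otimes U)\otimes(U'\otimes U')\cong(U\otimes U')\otimes(U\otimes U')$. A unit $(U,\delta)$ determines natural isomorphisms $\rho_X:X\to X\otimes U$, characterized by $\rho_X\otimes\mathrm{id}_U=\varphi_{X,U,U}\circ(\mathrm{id}_X\otimes\delta)$. An object of $\det((\mathrm{Gr}^{\mathrm b}(\mathcal E),T),\mathcal P)$ is a triple $g=(g_1,g_2,\mu)$, where $g_1:\mathrm{Gr}^{\mathrm b}(\mathcal E)_{\mathrm{iso}}\to\mathcal P$ is a functor and $g_2(\Delta):g_1(B)\to g_1(A)\otimes g_1(C)$ are isomorphisms for the short exact sequences $\Delta:0\to A\to B\to C\to0$, satisfying the analogues of (i)--(iii) (naturality for isomorphisms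 of short exact sequences; associativity for commutative diagrams of short exact sequences $A\to B\to C'$, $A\to C\to B'$, $B\to C\to A'$, $C'\to B'\to A'$; commutativity for split sequences), and where, for every $A$, $\mu_A$ is a unit structure on $g_1(A)\otimes g_1(TA)$ such that $g_1(a)\otimes g_1(Ta)$ is a morphism of units for every isomorphism $a:A\to B$, and such that for every short exact sequence $\Delta:0\to A\to B\to C\to 0$ the composite $$g_1(B)\otimes g_1(TB)\xrightarrow{g_2(\Delta)\otimes g_2(T\Delta)}(g_1(A)\otimes g_1(C))\otimes(g_1(TA)\otimes g_1(TC))\cong(g_1(A)\otimes g_1(TA))\otimes(g_1(C)\otimes g_1(TC))$$ is a morphism of units from $\mu_B$ to the product of $\mu_A$ and $\mu_C$. A morphism $g\to g'$ is a natural isomorphism $\lambda:g_1\to g'_1$ compatible with $g_2,g'_2$ such that each $\lambda_A\otimes\lambda_{TA}$ is a morphism of units from $\mu_A$ to $\mu'_A$. \emph{Construction.} Let $\tilde H:\mathcal T\to\mathrm{Gr}^{\mathrm b}(\mathcal E)$ be the functor $\tilde H(A)=(H(T^iA))_{i\in\mathbb Z}$. For a distinguished triangle $\Delta:A\xrightarrow{a}B\xrightarrow{b}C\xrightarrow{c}TA$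 the long exact sequence splits into short exact sequences $\Delta_1:\ker\tilde Hb\to\tilde HB\to\ker\tilde Hc$, $\Delta_2:\ker\tilde Ha\to\tilde HA\to\ker\tilde Hb$ and $\Delta_3:\ker\tilde Hc\to\tilde HC\to T\ker\tilde Ha$ in $\mathrm{Gr}^{\mathrm b}(\mathcal E)$. For $g=(g_1,g_2,\mu)$ in $\det((\mathrm{Gr}^{\mathrm b}(\mathcal E),T),\mathcal P)$ let $H^*(g)=(f_1,f_2)$, where $f_1=g_1\circ\tilde H$ and $f_2(\Delta)$ is the composite $$\begin{aligned}g_1(\tilde HB)&\xrightarrow{\ \rho\ }g_1(\tilde HB)\otimes g_1(\ker\tilde Ha)\otimes g_1(T\ker\tilde Ha)\\&\xrightarrow{g_2(\Delta_1)\otimes\mathrm{id}}g_1(\ker\tilde Hb)\otimes g_1(\ker\tilde Hc)\otimes g_1(\ker\tilde Ha)\otimes g_1(T\ker\tilde Ha)\\&\xrightarrow{\ \cong\ }g_1(\ker\tilde Ha)\otimes g_1(\ker\tilde Hb)\otimes g_1(\ker\tilde Hc)\otimes g_1(T\ker\tilde Ha)\\&\xrightarrow{g_2(\Delta_2)^{-1}\otimes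 g_2(\Delta_3)^{-1}}g_1(\tilde HA)\otimes g_1(\tilde HC),\end{aligned}$$ $\rho$ being the isomorphism belonging to the unit $(g_1(\ker\tilde Ha)\otimes g_1(T\ker\tilde Ha),\mu_{\ker\tilde Ha})$. \emph{Claim.} For every $g$ in $\det((\mathrm{Gr}^{\mathrm b}(\mathcal E),T),\mathcal P)$, the pair $H^*(g)$ is a determinant functor on $\mathcal T$ with values in $\mathcal P$. Moreover, for every morphism $\lambda:g\to g'$ the family $H^*(\lambda)_A=\lambda_{\tilde HA}$ is a morphism $H^*(g)\to H^*(g')$, and these assignments define a functor $$H^*:\det((\mathrm{Gr}^{\mathrm b}(\mathcal E),T),\mathcal P)\to\det(\mathcal T,\mathcal P).$$ -/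

import Mathlib

open CategoryTheory CategoryTheory.Limits CategoryTheory.Pretriangulated
open CategoryTheory.MonoidalCategory

universe v₁ u₁ v₂ u₂ v₃ u₃

namespace DetFun

/-! ### Picard categories and units -/

/-- A (commutative) Picard category: a symmetric monoidal category in which every morphism is an
isomorphism and `X ↦ W ⊗ X` is an autoequivalence for every object `W`. -/
class PicardCategory (P : Type u₃) [Category.{v₃} P] [MonoidalCategory P]
    [SymmetricCategory P] : Prop extends IsGroupoid P where
  isEquivalence_tensorLeft : ∀ W : P, (tensorLeft W).IsEquivalence

section Units

variable {P : Type u₃} [Category.{v₃} P] [MonoidalCategory P] [SymmetricCategory P]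

instance [PicardCategory P] (W : P) : (tensorRight W).IsEquivalence :=
  haveI := PicardCategory.isEquivalence_tensorLeft W
  Functor.isEquivalence_of_iso (BraidedCategory.tensorLeftIsoTensorRight W)

/-- A (reduced) unit structure on an object `U` of a Picard category. -/
abbrev UnitStr (U : P) := U ≅ U ⊗ U

/-- `α : U ⟶ U'` is a morphism of (reduced) units `(U, δ) ⟶ (U', δ')`. -/
def IsUnitHom {U U' : P} (δ : UnitStr U) (δ' : UnitStr U') (α : U ⟶ U') : Prop :=
  δ.hom ≫ (α ⊗ₘ α) = α ≫ δ'.hom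

/-- The canonical isomorphism exchanging the two middle factors. -/
def midSwap (X₁ X₂ Y₁ Y₂ : P) : (X₁ ⊗ X₂) ⊗ (Y₁ ⊗ Y₂) ≅ (X₁ ⊗ Y₁) ⊗ (X₂ ⊗ Y₂) where
  hom := tensorμ X₁ X₂ Y₁ Y₂
  inv := tensorδ X₁ X₂ Y₁ Y₂

/-- The product of two (reduced) units. -/
def UnitStr.prod {U U' : P} (δ : UnitStr U) (δ' : UnitStr U') : UnitStr (U ⊗ U') :=
  (δ ⊗ᵢ δ') ≪≫ midSwap U U U' U'

/-- The natural isomorphism `ρ_X : X ≅ X ⊗ U` belonging to a unit `(U, δ)`: the unique isomorphism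
with `ρ_X ⊗ id_U = (X ⊗ U ≅ X ⊗ (U ⊗ U) ≅ (X ⊗ U) ⊗ U)`, where the first map is `id_X ⊗ δ`. -/
noncomputable def UnitStr.ρ [PicardCategory P] {U : P} (δ : UnitStr U) (X : P) : X ≅ X ⊗ U :=
  (tensorRight U).preimageIso (whiskerLeftIso X δ ≪≫ (α_ X U U).symm)

end Units

/-! ### Determinant functors on exact categories -/

section Exact

variable {𝒜 : Type u₁} [Category.{v₁} 𝒜]

/-- The value of a functor on `𝒜_iso` at an object of `𝒜`. -/
abbrev ob {P : Type u₃} [Category.{v₃} P] (F : Core 𝒜 ⥤ P) (A : 𝒜) : P := F.obj ⟨A⟩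

/-- The value of a functor on `𝒜_iso` at an isomorphism of `𝒜`. -/
abbrev mp {P : Type u₃} [Category.{v₃} P] (F : Core 𝒜 ⥤ P) {A B : 𝒜} (e : A ≅ B) :
    ob F A ⟶ ob F B :=
  F.map (X := ⟨A⟩) (Y := ⟨B⟩) ⟨e⟩

variable [HasZeroMorphisms 𝒜]

/-- The data `(f₁, f₂)` underlying a determinant functor on an exact category `𝒜`; here `ses` is
the class of short exact sequences of `𝒜`. -/
structure ExactDetData (ses : ObjectProperty (ShortComplex 𝒜)) (P : Type u₃) [Category.{v₃} P]
    [MonoidalCategory P] where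
  f₁ : Core 𝒜 ⥤ P
  f₂ : ∀ S : ShortComplex 𝒜, ses S → (ob f₁ S.X₂ ≅ ob f₁ S.X₁ ⊗ ob f₁ S.X₃)

/-- The axioms of a determinant functor on an exact category. -/
structure ExactDetData.IsDeterminant {ses : ObjectProperty (ShortComplex 𝒜)} {P : Type u₃}
    [Category.{v₃} P] [MonoidalCategory P] [SymmetricCategory P]
    (f : ExactDetData ses P) : Prop where
  naturality : ∀ (S S' : ShortComplex 𝒜) (h : ses S) (h' : ses S')
    (a : S.X₁ ≅ S'.X₁) (b : S.X₂ ≅ S'.X₂) (c : S.X₃ ≅ S'.X₃),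
    S.f ≫ b.hom = a.hom ≫ S'.f → S.g ≫ c.hom = b.hom ≫ S'.g →
    (f.f₂ S h).hom ≫ (mp f.f₁ a ⊗ₘ mp f.f₁ c) = mp f.f₁ b ≫ (f.f₂ S' h').hom
  /-- Associativity for the diagram with rows `A ⟶ B ⟶ C'` (`a`, `b`) and `A ⟶ C ⟶ B'`
  (`u`, `e`), and columns `B ⟶ C ⟶ A'` (`c`, `p`) and `C' ⟶ B' ⟶ A'` (`d`, `g`). -/
  associativity : ∀ {A B C A' B' C' : 𝒜} (a : A ⟶ B) (b : B ⟶ C') (u : A ⟶ C) (e : C ⟶ B')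
    (c : B ⟶ C) (p : C ⟶ A') (d : C' ⟶ B') (g : B' ⟶ A')
    (wh1 : a ≫ b = 0) (wh2 : u ≫ e = 0) (wv1 : c ≫ p = 0) (wv2 : d ≫ g = 0)
    (h1 : ses (ShortComplex.mk a b wh1)) (h2 : ses (ShortComplex.mk u e wh2))
    (v1 : ses (ShortComplex.mk c p wv1)) (v2 : ses (ShortComplex.mk d g wv2)),
    a ≫ c = u → b ≫ d = c ≫ e → e ≫ g = p →
    (f.f₂ _ v1).hom ≫ ((f.f₂ _ h1).hom ▷ ob f.f₁ A') =
      (f.f₂ _ h2).hom ≫ (ob f.f₁ A ◁ (f.f₂ _ v2).hom) ≫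
        (α_ (ob f.f₁ A) (ob f.f₁ C') (ob f.f₁ A')).inv
  commutativity : ∀ {A B : 𝒜} (s : BinaryBicone A B) (_ : s.IsBilimit)
    (h1 : ses (ShortComplex.mk s.inl s.snd s.inl_snd))
    (h2 : ses (ShortComplex.mk s.inr s.fst s.inr_fst)),
    (f.f₂ _ h1).hom ≫ (β_ (ob f.f₁ A) (ob f.f₁ B)).hom = (f.f₂ _ h2).hom

/-- A determinant functor `(g₁, g₂, μ)` on an exact category with translation `(𝒜, T)`. -/
structure TransDet (ses : ObjectProperty (ShortComplex 𝒜)) (T : 𝒜 ⥤ 𝒜)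
    [T.PreservesZeroMorphisms] (hT : ∀ S, ses S → ses (S.map T))
    (P : Type u₃) [Category.{v₃} P] [MonoidalCategory P] [SymmetricCategory P]
    extends ExactDetData ses P where
  isDeterminant : toExactDetData.IsDeterminant
  μ : ∀ A : 𝒜, UnitStr (ob f₁ A ⊗ ob f₁ (T.obj A))
  μ_iso : ∀ {A B : 𝒜} (a : A ≅ B), IsUnitHom (μ A) (μ B) (mp f₁ a ⊗ₘ mp f₁ (T.mapIso a))
  μ_ses : ∀ (S : ShortComplex 𝒜) (h : ses S),
    IsUnitHom (μ S.X₂) ((μ S.X₁).prod (μ S.X₃))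
      (((f₂ S h).hom ⊗ₘ (f₂ (S.map T) (hT S h)).hom) ≫
        (midSwap (ob f₁ S.X₁) (ob f₁ S.X₃) (ob f₁ (T.obj S.X₁)) (ob f₁ (T.obj S.X₃))).hom)

namespace TransDet

variable {ses : ObjectProperty (ShortComplex 𝒜)} {T : 𝒜 ⥤ 𝒜} [T.PreservesZeroMorphisms]
  {hT : ∀ S, ses S → ses (S.map T)}
  {P : Type u₃} [Category.{v₃} P] [MonoidalCategory P] [SymmetricCategory P]

/-- A morphism of determinant functors on an exact category with translation. -/
@[ext]
structure Hom (g g' : TransDet ses T hT P) where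
  iso : g.f₁ ≅ g'.f₁
  comm : ∀ (S : ShortComplex 𝒜) (h : ses S),
    (g.f₂ S h).hom ≫ (iso.hom.app ⟨S.X₁⟩ ⊗ₘ iso.hom.app ⟨S.X₃⟩) =
      iso.hom.app ⟨S.X₂⟩ ≫ (g'.f₂ S h).hom
  unit : ∀ A : 𝒜, IsUnitHom (g.μ A) (g'.μ A) (iso.hom.app ⟨A⟩ ⊗ₘ iso.hom.app ⟨T.obj A⟩)

/-- The category `det((𝒜, T), P)`. -/
instance : Category (TransDet ses T hT P) where
  Hom := Hom
  id g :=
    { iso := Iso.refl _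
      comm := by intros; simp
      unit := by intros; simp [IsUnitHom] }
  comp {g g' g''} l m :=
    { iso := l.iso ≪≫ m.iso
      comm := by
        intro S h
        simp only [Iso.trans_hom, NatTrans.comp_app, ← tensorHom_comp_tensorHom, Category.assoc]
        rw [← m.comm S h, ← Category.assoc, l.comm S h, Category.assoc]
      unit := by
        intro A
        have h1 := l.unit A
        have h2 := m.unit A
        simp only [IsUnitHom, Iso.trans_hom, NatTrans.comp_app,
          ← tensorHom_comp_tensorHom, Category.assoc] at h1 h2 ⊢
        rw [← h2, ← Category.assoc, h1, Category.assoc] }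
  id_comp _ := Hom.ext (Iso.ext (Category.id_comp _))
  comp_id _ := Hom.ext (Iso.ext (Category.comp_id _))
  assoc _ _ _ := Hom.ext (Iso.ext (Category.assoc _ _ _))

end TransDet

end Exact

/-! ### Determinant functors on triangulated categories -/

section Triangulated

variable (𝒯 : Type u₁) [Category.{v₁} 𝒯] [Preadditive 𝒯] [HasZeroObject 𝒯] [HasShift 𝒯 ℤ]
  [∀ n : ℤ, (shiftFunctor 𝒯 n).Additive] [Pretriangulated 𝒯]
  (P : Type u₃) [Category.{v₃} P] [MonoidalCategory P]

/-- The data `(f₁, f₂)` underlying a determinant functor on a triangulated category. -/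
structure TriDetData where
  f₁ : Core 𝒯 ⥤ P
  f₂ : ∀ Δ : Triangle 𝒯, Δ ∈ distTriang 𝒯 → (ob f₁ Δ.obj₂ ≅ ob f₁ Δ.obj₁ ⊗ ob f₁ Δ.obj₃)

variable {𝒯 P}

/-- The axioms of a determinant functor on a triangulated category. -/
structure TriDetData.IsDeterminant [SymmetricCategory P] (f : TriDetData 𝒯 P) : Prop where
  naturality : ∀ (Δ Δ' : Triangle 𝒯) (h : Δ ∈ distTriang 𝒯) (h' : Δ' ∈ distTriang 𝒯)
    (a : Δ.obj₁ ≅ Δ'.obj₁) (b : Δ.obj₂ ≅ Δ'.obj₂) (c : Δ.obj₃ ≅ Δ'.obj₃),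
    Δ.mor₁ ≫ b.hom = a.hom ≫ Δ'.mor₁ → Δ.mor₂ ≫ c.hom = b.hom ≫ Δ'.mor₂ →
    Δ.mor₃ ≫ (shiftFunctor 𝒯 (1 : ℤ)).map a.hom = c.hom ≫ Δ'.mor₃ →
    (f.f₂ Δ h).hom ≫ (mp f.f₁ a ⊗ₘ mp f.f₁ c) = mp f.f₁ b ≫ (f.f₂ Δ' h').hom
  /-- Associativity for the octahedral diagram with horizontal triangles
  `A ⟶ B ⟶ C' ⟶ TA` (`a`, `b`, `x`) and `A ⟶ C ⟶ B' ⟶ TA` (`u`, `e`, `z`), and vertical triangles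
  `B ⟶ C ⟶ A' ⟶ TB` (`c`, `p`, `y`) and `C' ⟶ B' ⟶ A' ⟶ TC'` (`o.m₁`, `o.m₃`, `Tb ∘ y`). -/
  associativity : ∀ {A B C A' B' C' : 𝒯} {a : A ⟶ B} {c : B ⟶ C} {u : A ⟶ C} (w : a ≫ c = u)
    {b : B ⟶ C'} {x : C' ⟶ (shiftFunctor 𝒯 (1 : ℤ)).obj A}
    (h1 : Triangle.mk a b x ∈ distTriang 𝒯)
    {p : C ⟶ A'} {y : A' ⟶ (shiftFunctor 𝒯 (1 : ℤ)).obj B}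
    (v1 : Triangle.mk c p y ∈ distTriang 𝒯)
    {e : C ⟶ B'} {z : B' ⟶ (shiftFunctor 𝒯 (1 : ℤ)).obj A}
    (h2 : Triangle.mk u e z ∈ distTriang 𝒯)
    (o : Triangulated.Octahedron w h1 v1 h2),
    (f.f₂ _ v1).hom ≫ ((f.f₂ _ h1).hom ▷ ob f.f₁ A') =
      (f.f₂ _ h2).hom ≫ (ob f.f₁ A ◁ (f.f₂ _ o.mem).hom) ≫
        (α_ (ob f.f₁ A) (ob f.f₁ C') (ob f.f₁ A')).inv
  commutativity : ∀ {A B : 𝒯} (s : BinaryBicone A B) (_ : s.IsBilimit)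
    (h1 : Triangle.mk s.inl s.snd (0 : B ⟶ (shiftFunctor 𝒯 (1 : ℤ)).obj A) ∈ distTriang 𝒯)
    (h2 : Triangle.mk s.inr s.fst (0 : A ⟶ (shiftFunctor 𝒯 (1 : ℤ)).obj B) ∈ distTriang 𝒯),
    (f.f₂ _ h1).hom ≫ (β_ (ob f.f₁ A) (ob f.f₁ B)).hom = (f.f₂ _ h2).hom

/-- Compatibility of a natural isomorphism `f₁ ≅ f'₁` with `f₂` and `f'₂`. -/
def TriDetData.IsMorphism {f f' : TriDetData 𝒯 P} (l : f.f₁ ≅ f'.f₁) : Prop :=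
  ∀ (Δ : Triangle 𝒯) (h : Δ ∈ distTriang 𝒯),
    (f.f₂ Δ h).hom ≫ (l.hom.app ⟨Δ.obj₁⟩ ⊗ₘ l.hom.app ⟨Δ.obj₃⟩) =
      l.hom.app ⟨Δ.obj₂⟩ ≫ (f'.f₂ Δ h).hom

variable (𝒯 P) in
/-- A determinant functor on a triangulated category. -/
structure TriDet [SymmetricCategory P] where
  data : TriDetData 𝒯 P
  isDeterminant : data.IsDeterminant

namespace TriDet

variable [SymmetricCategory P]

/-- A morphism of determinant functors on a triangulated category. -/
@[ext]
structure Hom (f f' : TriDet 𝒯 P) where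
  iso : f.data.f₁ ≅ f'.data.f₁
  comm : TriDetData.IsMorphism iso

/-- The category `det(𝒯, P)`. -/
instance : Category (TriDet 𝒯 P) where
  Hom := Hom
  id f :=
    { iso := Iso.refl _
      comm := by intro Δ h; simp }
  comp {f f' f''} l m :=
    { iso := l.iso ≪≫ m.iso
      comm := by
        intro Δ h
        simp only [Iso.trans_hom, NatTrans.comp_app, ← tensorHom_comp_tensorHom, Category.assoc]
        rw [← m.comm Δ h, ← Category.assoc, l.comm Δ h, Category.assoc] }
  id_comp _ := Hom.ext (Iso.ext (Category.id_comp _))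
  comp_id _ := Hom.ext (Iso.ext (Category.comp_id _))
  assoc _ _ _ := Hom.ext (Iso.ext (Category.assoc _ _ _))

end TriDet

end Triangulated

/-! ### Bounded graded objects -/

section Graded

variable (E : Type u₂) [Category.{v₂} E] [Abelian E]

/-- A graded object is bounded if all but finitely many of its components are zero objects. -/
def boundedGraded : ObjectProperty (GradedObject ℤ E) :=
  fun A => {i : ℤ | ¬ IsZero (A i)}.Finite

/-- The category `Gr^b(E)` of bounded `ℤ`-graded objects of `E`. -/
abbrev GrB := (boundedGraded E).FullSubcategory

/-- The degree `i` component functor. -/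
abbrev GrB.ev (i : ℤ) : GrB E ⥤ E := (boundedGraded E).ι ⋙ GradedObject.eval i

instance (i : ℤ) : (GrB.ev E i).PreservesZeroMorphisms where
  map_zero _ _ := rfl

/-- The short exact sequences of `Gr^b(E)` are the degreewise short exact ones. -/
def GrB.ses : ObjectProperty (ShortComplex (GrB E)) :=
  fun S => ∀ i : ℤ, (S.map (GrB.ev E i)).ShortExact

/-- The translation of `Gr^b(E)`: `(TA)_j = A_{j+1}` and `(Ta)_j = a_{j+1}`. -/
def GrB.T : GrB E ⥤ GrB E where
  obj A := ⟨fun j => A.obj (j + 1), A.property.preimage (add_left_injective (1 : ℤ)).injOn⟩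
  map a := ObjectProperty.homMk (fun j => a.hom (j + 1))

instance : (GrB.T E).PreservesZeroMorphisms where
  map_zero _ _ := rfl

lemma GrB.ses_map_T (S : ShortComplex (GrB E)) (h : GrB.ses E S) :
    GrB.ses E (S.map (GrB.T E)) :=
  fun i => h (i + 1)

/-- The category `det((Gr^b(E), T), P)`. -/
abbrev GrDet (P : Type u₃) [Category.{v₃} P] [MonoidalCategory P] [SymmetricCategory P] :=
  TransDet (GrB.ses E) (GrB.T E) (GrB.ses_map_T E) P

variable {E}

/-- The kernel of a morphism in `Gr^b(E)`, formed degreewise. -/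
noncomputable def GrB.ker {A B : GrB E} (a : A ⟶ B) : GrB E where
  obj i := kernel (a.hom i)
  property := A.property.subset fun i hi hA =>
    hi (IsZero.of_mono (kernel.ι (a.hom i)) hA)

/-- The inclusion of the kernel. -/
noncomputable def GrB.kerι {A B : GrB E} (a : A ⟶ B) : GrB.ker a ⟶ A :=
  ObjectProperty.homMk fun i => kernel.ι (a.hom i)

/-- The morphism to `ker b` induced by a morphism `a` with `b ∘ a = 0`. -/
noncomputable def GrB.kerLift {A B C : GrB E} (a : A ⟶ B) (b : B ⟶ C)
    (w : ∀ i, a.hom i ≫ b.hom i = 0) : A ⟶ GrB.ker b :=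
  ObjectProperty.homMk fun i => kernel.lift (b.hom i) (a.hom i) (w i)

/-- The sequence `0 ⟶ ker a ⟶ A ⟶ ker b ⟶ 0` obtained from `a : A ⟶ B` and `b : B ⟶ C`. -/
noncomputable def GrB.kerSeq {A B C : GrB E} (a : A ⟶ B) (b : B ⟶ C)
    (w : ∀ i, a.hom i ≫ b.hom i = 0) : ShortComplex (GrB E) where
  f := GrB.kerι a
  g := GrB.kerLift a b w
  zero := by
    ext i
    apply (cancel_mono (kernel.ι (b.hom i))).1
    exact (Category.assoc _ _ _).trans ((congrArg _ (kernel.lift_ι _ _ _)).trans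
      ((kernel.condition (a.hom i)).trans zero_comp.symm))

/-- `a : A ⟶ B` and `b : B ⟶ C` form a degreewise exact sequence. -/
def GrB.ExactAt {A B C : GrB E} (a : A ⟶ B) (b : B ⟶ C) : Prop :=
  ∀ i, ∃ w : a.hom i ≫ b.hom i = 0, (ShortComplex.mk _ _ w).Exact

lemma GrB.ExactAt.w {A B C : GrB E} {a : A ⟶ B} {b : B ⟶ C} (h : GrB.ExactAt a b) :
    ∀ i, a.hom i ≫ b.hom i = 0 := fun i => (h i).1

lemma kerSeq_shortExact {X Y Z K : E} {a : X ⟶ Y} {b : Y ⟶ Z} (w : a ≫ b = 0)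
    (h : (ShortComplex.mk a b w).Exact) (k : K ⟶ X) (wk : k ≫ a = 0)
    (hk : IsLimit (KernelFork.ofι k wk)) (z : k ≫ kernel.lift b a w = 0) :
    (ShortComplex.mk k (kernel.lift b a w) z).ShortExact := by
  have : Mono k := mono_of_isLimit_fork hk
  have : Epi (kernel.lift b a w) := h.epi_kernelLift
  refine ShortComplex.ShortExact.mk' ?_ ‹_› ‹_›
  refine ShortComplex.exact_of_f_is_kernel _ (KernelFork.IsLimit.ofι' _ _ fun {W} s hs => ?_)
  have hs' : s ≫ a = 0 := by
    have := congrArg (· ≫ kernel.ι b) hs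
    simpa using this
  exact ⟨hk.lift (KernelFork.ofι s hs'), hk.fac (KernelFork.ofι s hs') .zero⟩

lemma GrB.kerSeq_ses {A B C : GrB E} (a : A ⟶ B) (b : B ⟶ C) (h : GrB.ExactAt a b) :
    GrB.ses E (GrB.kerSeq a b h.w) :=
  fun i => kerSeq_shortExact (h i).1 (h i).2 _ (kernel.condition (a.hom i))
    (kernelIsKernel (a.hom i)) _

end Graded

/-! ### The functor induced by a bounded cohomological functor -/

section Cohomological

variable {𝒯 : Type u₁} [Category.{v₁} 𝒯] [Preadditive 𝒯] [HasZeroObject 𝒯] [HasShift 𝒯 ℤ]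
  [∀ n : ℤ, (shiftFunctor 𝒯 n).Additive] [Pretriangulated 𝒯]
  {E : Type u₂} [Category.{v₂} E] [Abelian E]

/-- `H` is bounded: for each `A`, `H(TⁱA) = 0` for all but finitely many `i`. -/
def IsBounded (H : 𝒯 ⥤ E) : Prop :=
  ∀ A : 𝒯, {i : ℤ | ¬ IsZero (H.obj ((shiftFunctor 𝒯 i).obj A))}.Finite

/-- The functor `H̃ : 𝒯 ⥤ Gr^b(E)` with `H̃(A)_i = H(TⁱA)` and `H̃(a)_i = H(Tⁱa)`. -/
def tilde (H : 𝒯 ⥤ E) (hH : IsBounded H) : 𝒯 ⥤ GrB E where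
  obj A := ⟨fun i => H.obj ((shiftFunctor 𝒯 i).obj A), hH A⟩
  map a := ObjectProperty.homMk fun i => H.map ((shiftFunctor 𝒯 i).map a)

/-- The canonical isomorphism `H̃(TA) ≅ T(H̃A)`. -/
noncomputable def tildeShift (H : 𝒯 ⥤ E) (hH : IsBounded H) (A : 𝒯) :
    (tilde H hH).obj ((shiftFunctor 𝒯 (1 : ℤ)).obj A) ≅ (GrB.T E).obj ((tilde H hH).obj A) :=
  ObjectProperty.isoMk _ (GradedObject.isoMk _ _ fun i =>
    H.mapIso ((shiftFunctorAdd' 𝒯 1 i (i + 1) (add_comm 1 i)).symm.app A))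

/-- The morphism `H̃c : H̃C ⟶ T(H̃A)` for `c : C ⟶ TA`. -/
noncomputable def tildeδ (H : 𝒯 ⥤ E) (hH : IsBounded H) {C A : 𝒯}
    (c : C ⟶ (shiftFunctor 𝒯 (1 : ℤ)).obj A) :
    (tilde H hH).obj C ⟶ (GrB.T E).obj ((tilde H hH).obj A) :=
  (tilde H hH).map c ≫ (tildeShift H hH A).hom

variable (H : 𝒯 ⥤ E) [H.IsHomological] (hH : IsBounded H)
  (Δ : Triangle 𝒯)

lemma exactAt₂ (hΔ : Δ ∈ distTriang 𝒯) : GrB.ExactAt ((tilde H hH).map Δ.mor₁) ((tilde H hH).map Δ.mor₂) := by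
  intro i
  let _ := Functor.ShiftSequence.tautological H ℤ
  exact ⟨_, H.homologySequence_exact₂ Δ hΔ i⟩

lemma exactAt₃ (hΔ : Δ ∈ distTriang 𝒯) : GrB.ExactAt ((tilde H hH).map Δ.mor₂) (tildeδ H hH Δ.mor₃) := by
  intro i
  let _ := Functor.ShiftSequence.tautological H ℤ
  have key : (tildeδ H hH Δ.mor₃).hom i = H.homologySequenceδ Δ i (i + 1) rfl := by
    change _ = H.map _ ≫ (𝟙 _ ≫ H.map _)
    rw [Category.id_comp]
    rfl
  rw [key]
  exact ⟨_, H.homologySequence_exact₃ Δ hΔ i (i + 1) rfl⟩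

lemma exactAt₁ (hΔ : Δ ∈ distTriang 𝒯) : GrB.ExactAt (tildeδ H hH Δ.mor₃)
    ((GrB.T E).map ((tilde H hH).map Δ.mor₁)) := by
  intro i
  let _ := Functor.ShiftSequence.tautological H ℤ
  have key : (tildeδ H hH Δ.mor₃).hom i = H.homologySequenceδ Δ i (i + 1) rfl := by
    change _ = H.map _ ≫ (𝟙 _ ≫ H.map _)
    rw [Category.id_comp]
    rfl
  rw [key]
  exact ⟨_, H.homologySequence_exact₁ Δ hΔ i (i + 1) rfl⟩

/-- `Δ₁ : 0 ⟶ ker H̃b ⟶ H̃B ⟶ ker H̃c ⟶ 0`. -/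
noncomputable def seq₁ (hΔ : Δ ∈ distTriang 𝒯) : ShortComplex (GrB E) :=
  GrB.kerSeq ((tilde H hH).map Δ.mor₂) (tildeδ H hH Δ.mor₃) (exactAt₃ H hH Δ hΔ).w

/-- `Δ₂ : 0 ⟶ ker H̃a ⟶ H̃A ⟶ ker H̃b ⟶ 0`. -/
noncomputable def seq₂ (hΔ : Δ ∈ distTriang 𝒯) : ShortComplex (GrB E) :=
  GrB.kerSeq ((tilde H hH).map Δ.mor₁) ((tilde H hH).map Δ.mor₂) (exactAt₂ H hH Δ hΔ).w

/-- `Δ₃ : 0 ⟶ ker H̃c ⟶ H̃C ⟶ T(ker H̃a) ⟶ 0`, using that `T(ker H̃a)` is `ker T(H̃a)`. -/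
noncomputable def seq₃ (hΔ : Δ ∈ distTriang 𝒯) : ShortComplex (GrB E) :=
  GrB.kerSeq (tildeδ H hH Δ.mor₃) ((GrB.T E).map ((tilde H hH).map Δ.mor₁))
    (exactAt₁ H hH Δ hΔ).w

lemma seq₁_ses (hΔ : Δ ∈ distTriang 𝒯) :
    GrB.ses E (seq₁ H hH Δ hΔ) := GrB.kerSeq_ses _ _ (exactAt₃ H hH Δ hΔ)

lemma seq₂_ses (hΔ : Δ ∈ distTriang 𝒯) :
    GrB.ses E (seq₂ H hH Δ hΔ) := GrB.kerSeq_ses _ _ (exactAt₂ H hH Δ hΔ)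

lemma seq₃_ses (hΔ : Δ ∈ distTriang 𝒯) :
    GrB.ses E (seq₃ H hH Δ hΔ) := GrB.kerSeq_ses _ _ (exactAt₁ H hH Δ hΔ)

variable {P : Type u₃} [Category.{v₃} P] [MonoidalCategory P] [SymmetricCategory P]
  [PicardCategory P]

/-- The pair `H^*(g) = (f₁, f₂)`: `f₁ = g₁ ∘ H̃`, and `f₂(Δ)` is the composite
`[H̃B] ≅ [H̃B] ⊗ ([Ka] ⊗ [TKa]) ≅ ([Kb] ⊗ [Kc]) ⊗ ([Ka] ⊗ [TKa]) ≅ ([Ka] ⊗ [Kb]) ⊗ ([Kc] ⊗ [TKa])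
≅ [H̃A] ⊗ [H̃C]`, where `[-]` stands for `g₁` and `Ka`, `Kb`, `Kc` for the kernels of
`H̃a`, `H̃b`, `H̃c`. -/
noncomputable def starData (g : GrDet E P) : TriDetData 𝒯 P where
  f₁ := (tilde H hH).core ⋙ g.f₁
  f₂ Δ hΔ :=
    let Ka := GrB.ker ((tilde H hH).map Δ.mor₁)
    let Kb := GrB.ker ((tilde H hH).map Δ.mor₂)
    let Kc := GrB.ker (tildeδ H hH Δ.mor₃)
    let TKa := (GrB.T E).obj Ka
    (g.μ Ka).ρ (ob g.f₁ ((tilde H hH).obj Δ.obj₂)) ≪≫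
    whiskerRightIso (g.f₂ (seq₁ H hH Δ hΔ) (seq₁_ses H hH Δ hΔ)) (ob g.f₁ Ka ⊗ ob g.f₁ TKa) ≪≫
    midSwap (ob g.f₁ Kb) (ob g.f₁ Kc) (ob g.f₁ Ka) (ob g.f₁ TKa) ≪≫
    whiskerRightIso (β_ (ob g.f₁ Kb) (ob g.f₁ Ka)) (ob g.f₁ Kc ⊗ ob g.f₁ TKa) ≪≫
    ((g.f₂ (seq₂ H hH Δ hΔ) (seq₂_ses H hH Δ hΔ)).symm ⊗ᵢ
      (g.f₂ (seq₃ H hH Δ hΔ) (seq₃_ses H hH Δ hΔ)).symm)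

/-- The natural isomorphism `H^*(l)_A = l_{H̃A}` induced by a morphism `l : g ⟶ g'`. -/
noncomputable def starIso {g g' : GrDet E P} (l : g ⟶ g') :
    (starData H hH g).f₁ ≅ (starData H hH g').f₁ :=
  Functor.isoWhiskerLeft (tilde H hH).core (TransDet.Hom.iso l)

end Cohomological

end DetFun

/-!
For a long exact sequence `⋯ ⟶ A ⟶ B ⟶ C ⟶ TA ⟶ ⋯` of graded objects, the isomorphism
`[B] ≅ [A] ⊗ [C]` (`exactSplice`) is glued from the three short exact sequences into which the long
exact sequence splits, after the introduction of the unit `[ker a] ⊗ [T (ker a)]`. Everything is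
proved for such long exact sequences; the triangulated category enters only through the fact that
`H̃` turns distinguished triangles, octahedra and direct sums into long exact sequences, octahedra of
long exact sequences and direct sums. Naturality, and compatibility with morphisms, are immediate
from the naturality of the ingredients (`splice_natural`).

**Associativity.** In an octahedron `A ⟶ B ⟶ C'`, `A ⟶ C ⟶ B'`, `B ⟶ C ⟶ A'`, `C' ⟶ B' ⟶ A'` of long
exact sequences, all objects and all kernels have filtrations whose quotients are six elementary
pieces `K₁, …, K₆` and the translates of `K₁`, `K₂` and `K₄`. The kernels of four of the twelve
morphisms are pieces; short exact sequences decompose each of the others into a pair of pieces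
(`GrB.ses_kernels`). For `A`, `C`, `A'`, `C'` the
two resulting decompositions are compared by the associativity axiom
(`ExactDetData.IsDeterminant.associativity_kernels`). For `B` and `B'` they come from a `3 × 3` diagram
with exact rows and columns, for which they agree up to exchanging the middle factors
(`ExactDetData.IsDeterminant.three_by_three`); this is where the commutativity axiom is needed. The
units attached to `ker (A ⟶ C)` and `ker (B ⟶ C)` are products of the units attached to `K₁`, `K₂`
and to `K₂`, `K₄`, so that both sides of the associativity axiom introduce the same unit, made of `K₁`,
`K₂`, `K₄` and their translates. All that remains is an equality between composites of associativity
and commutativity isomorphisms of products of nine distinct objects (`splice_octahedron`).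

**Coherence.** Such composites agree because no object is repeated (`TensorWord.Str.eval_eq`). To see
this, one writes the family `(Xᵢ)` of objects as the product of the families
`(𝟙, …, 𝟙, Xᵢ, 𝟙, …, 𝟙)`. Structural isomorphisms are natural and compatible with products of
families, so one may assume that all objects but one are trivial; then a structural isomorphism
commutes with the canonical isomorphisms to the remaining object. In a symmetric monoidal category
this would fail if an object occurred twice, and therefore the nine pieces have to be treated as
distinct variables, even where they might be isomorphic.

**Commutativity.** For a split triangle the long exact sequence consists of short exact sequences
`0 ⟶ A ⟶ B ⟶ C ⟶ 0`. The unit belongs to a zero object, whose determinant is trivialized by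
`0 ⟶ 0 ⟶ 0`, and `exactSplice` is the given isomorphism of the short exact sequence
(`exactSplice_of_ses`).
-/

namespace DetFun

/-! ### Coherence for symmetric monoidal categories -/

section Coherence

/-- Formal tensor products of the variables in `ι`. There is no unit: the units occurring below
are the objects `[K] ⊗ [TK]`, which are products of variables. -/
inductive TensorWord (ι : Type) : Type
  | var (i : ι) : TensorWord ι
  | mul (e e' : TensorWord ι) : TensorWord ι

namespace TensorWord

/-- Formal composites of associativity and commutativity isomorphisms. -/
inductive Str {ι : Type} : TensorWord ι → TensorWord ι → Type
  | refl (e) : Str e e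
  | symm {e e'} (t : Str e e') : Str e' e
  | trans {e e' e''} (t : Str e e') (t' : Str e' e'') : Str e e''
  | tensor {e₁ e₁' e₂ e₂'} (t₁ : Str e₁ e₁') (t₂ : Str e₂ e₂') : Str (mul e₁ e₂) (mul e₁' e₂')
  | assoc (e e' e'') : Str (mul (mul e e') e'') (mul e (mul e' e''))
  | comm (e e') : Str (mul e e') (mul e' e)

/-- The number of occurrences of the variable `i`. -/
def count {ι : Type} [DecidableEq ι] (i : ι) : TensorWord ι → ℕ
  | var j => if j = i then 1 else 0
  | mul e e' => count i e + count i e'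

variable {ι : Type} {P : Type u₃} [Category.{v₃} P] [MonoidalCategory P] [SymmetricCategory P]

/-- The value of a formal tensor product at a family of objects. -/
def eval (X : ι → P) : TensorWord ι → P
  | var i => X i
  | mul e e' => eval X e ⊗ eval X e'

/-- The value of a formal structural isomorphism at a family of objects. -/
def Str.eval (X : ι → P) : {e e' : TensorWord ι} → Str e e' → (e.eval X ≅ e'.eval X)
  | _, _, .refl _ => Iso.refl _
  | _, _, .symm t => (t.eval X).symm
  | _, _, .trans t t' => t.eval X ≪≫ t'.eval X
  | _, _, .tensor t t' => t.eval X ⊗ᵢ t'.eval X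
  | _, _, .assoc e e' e'' => α_ (e.eval X) (e'.eval X) (e''.eval X)
  | _, _, .comm e e' => β_ (e.eval X) (e'.eval X)

/-- Evaluation respects isomorphisms of families. -/
def evalIso {X Y : ι → P} (h : ∀ i, X i ≅ Y i) : (e : TensorWord ι) → (e.eval X ≅ e.eval Y)
  | var i => h i
  | mul e e' => evalIso h e ⊗ᵢ evalIso h e'

lemma Str.eval_natural {X Y : ι → P} (h : ∀ i, X i ≅ Y i) {e e' : TensorWord ι} (t : Str e e') :
    (t.eval X).hom ≫ (evalIso h e').hom = (evalIso h e).hom ≫ (t.eval Y).hom := by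
  induction t with
  | refl e => simp [Str.eval]
  | symm t ih =>
    simp only [Str.eval, Iso.symm_hom]
    rw [Iso.inv_comp_eq, ← Category.assoc, ih, Category.assoc, Iso.hom_inv_id, Category.comp_id]
  | trans t t' ih ih' => simp only [Str.eval, Iso.trans_hom, Category.assoc, ih', reassoc_of% ih]
  | tensor t t' ih ih' =>
    change ((t.eval X).hom ⊗ₘ (t'.eval X).hom) ≫ ((evalIso h _).hom ⊗ₘ (evalIso h _).hom) =
      ((evalIso h _).hom ⊗ₘ (evalIso h _).hom) ≫ ((t.eval Y).hom ⊗ₘ (t'.eval Y).hom)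
    simp only [tensorHom_comp_tensorHom, ih, ih']
  | assoc e e' e'' =>
    exact (associator_naturality (evalIso h e).hom (evalIso h e').hom (evalIso h e'').hom).symm
  | comm e e' =>
    exact (BraidedCategory.braiding_naturality (evalIso h e).hom (evalIso h e').hom).symm

/-- Evaluation at a product of two families is the product of the evaluations. -/
def evalMul (X Y : ι → P) : (e : TensorWord ι) → (e.eval X ⊗ e.eval Y ≅ e.eval fun i => X i ⊗ Y i)
  | var _ => Iso.refl _
  | mul e e' => midSwap _ _ _ _ ≪≫ (evalMul X Y e ⊗ᵢ evalMul X Y e')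

lemma tensorμ_comm (X₁ X₂ Y₁ Y₂ : P) :
    tensorμ X₁ X₂ Y₁ Y₂ ≫ (β_ (X₁ ⊗ Y₁) (X₂ ⊗ Y₂)).hom =
      ((β_ X₁ X₂).hom ⊗ₘ (β_ Y₁ Y₂).hom) ≫ tensorμ X₂ X₁ Y₂ Y₁ := by
  have h : X₁ ◁ (β_ X₂ Y₁).hom ▷ Y₂ ≫ X₁ ◁ (β_ Y₁ X₂).hom ▷ Y₂ = 𝟙 _ := by
    simp [← whiskerLeft_comp, ← comp_whiskerRight]
  have e : tensorμ X₁ X₂ Y₁ Y₂ ≫ (β_ (X₁ ⊗ Y₁) (X₂ ⊗ Y₂)).hom =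
    𝟙 _ ⊗≫ (X₁ ◁ (β_ X₂ Y₁).hom ▷ Y₂ ≫ X₁ ◁ (β_ Y₁ X₂).hom ▷ Y₂) ⊗≫
      ((β_ X₁ X₂).hom ▷ (Y₁ ⊗ Y₂) ≫ (X₂ ⊗ X₁) ◁ (β_ Y₁ Y₂).hom) ⊗≫
        X₂ ◁ (β_ X₁ Y₂).hom ▷ Y₁ ⊗≫ 𝟙 _ := by
    simp only [tensorμ, BraidedCategory.braiding_tensor_left_hom,
      BraidedCategory.braiding_tensor_right_hom]
    monoidal
  rw [e, h, MonoidalCategory.tensorHom_def, tensorμ]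
  monoidal

lemma tensorμ_assoc (X₁ X₂ X₃ Y₁ Y₂ Y₃ : P) {Z₁ Z₂ Z₃ : P}
    (f₁ : X₁ ⊗ Y₁ ⟶ Z₁) (f₂ : X₂ ⊗ Y₂ ⟶ Z₂) (f₃ : X₃ ⊗ Y₃ ⟶ Z₃) :
    ((α_ X₁ X₂ X₃).hom ⊗ₘ (α_ Y₁ Y₂ Y₃).hom) ≫ tensorμ X₁ (X₂ ⊗ X₃) Y₁ (Y₂ ⊗ Y₃) ≫
        (f₁ ⊗ₘ (tensorμ X₂ X₃ Y₂ Y₃ ≫ (f₂ ⊗ₘ f₃))) =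
      (tensorμ (X₁ ⊗ X₂) X₃ (Y₁ ⊗ Y₂) Y₃ ≫ ((tensorμ X₁ X₂ Y₁ Y₂ ≫ (f₁ ⊗ₘ f₂)) ⊗ₘ f₃)) ≫
        (α_ Z₁ Z₂ Z₃).hom := by
  have h := associator_monoidal X₁ X₂ X₃ Y₁ Y₂ Y₃
  have h₁ : f₁ ⊗ₘ (tensorμ X₂ X₃ Y₂ Y₃ ≫ (f₂ ⊗ₘ f₃)) =
      ((X₁ ⊗ Y₁) ◁ tensorμ X₂ X₃ Y₂ Y₃) ≫ (f₁ ⊗ₘ f₂ ⊗ₘ f₃) := by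
    rw [← id_tensorHom, tensorHom_comp_tensorHom, Category.id_comp]
  have h₂ : (tensorμ X₁ X₂ Y₁ Y₂ ≫ (f₁ ⊗ₘ f₂)) ⊗ₘ f₃ =
      (tensorμ X₁ X₂ Y₁ Y₂ ▷ (X₃ ⊗ Y₃)) ≫ ((f₁ ⊗ₘ f₂) ⊗ₘ f₃) := by
    rw [← tensorHom_id, tensorHom_comp_tensorHom, Category.id_comp]
  rw [h₁, h₂, Category.assoc, Category.assoc, associator_naturality, reassoc_of% h]

lemma Str.eval_mul (X Y : ι → P) {e e' : TensorWord ι} (t : Str e e') :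
    ((t.eval X).hom ⊗ₘ (t.eval Y).hom) ≫ (evalMul X Y e').hom =
      (evalMul X Y e).hom ≫ (t.eval fun i => X i ⊗ Y i).hom := by
  induction t with
  | refl e => simp [Str.eval]
  | symm t ih =>
    simp only [Str.eval, Iso.symm_hom]
    rw [Iso.eq_comp_inv, Category.assoc, ← ih, tensorHom_comp_tensorHom_assoc]
    simp
  | trans t t' ih ih' =>
    simp only [Str.eval, Iso.trans_hom, ← tensorHom_comp_tensorHom, Category.assoc, ih',
      reassoc_of% ih]
  | tensor t t' ih ih' =>
    change (((t.eval X).hom ⊗ₘ (t'.eval X).hom) ⊗ₘ ((t.eval Y).hom ⊗ₘ (t'.eval Y).hom)) ≫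
      tensorμ _ _ _ _ ≫ ((evalMul X Y _).hom ⊗ₘ (evalMul X Y _).hom) =
      (tensorμ _ _ _ _ ≫ ((evalMul X Y _).hom ⊗ₘ (evalMul X Y _).hom)) ≫
        ((t.eval fun i => X i ⊗ Y i).hom ⊗ₘ (t'.eval fun i => X i ⊗ Y i).hom)
    rw [reassoc_of% tensorμ_natural, tensorHom_comp_tensorHom, ih, ih', Category.assoc,
      tensorHom_comp_tensorHom]
  | assoc e e' e'' =>
    change ((α_ (e.eval X) (e'.eval X) (e''.eval X)).hom ⊗ₘ
        (α_ (e.eval Y) (e'.eval Y) (e''.eval Y)).hom) ≫ tensorμ _ _ _ _ ≫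
        ((evalMul X Y e).hom ⊗ₘ (tensorμ _ _ _ _ ≫
          ((evalMul X Y e').hom ⊗ₘ (evalMul X Y e'').hom))) =
      (tensorμ _ _ _ _ ≫ ((tensorμ _ _ _ _ ≫
        ((evalMul X Y e).hom ⊗ₘ (evalMul X Y e').hom)) ⊗ₘ (evalMul X Y e'').hom)) ≫
        (α_ _ _ _).hom
    exact tensorμ_assoc _ _ _ _ _ _ _ _ _
  | comm e e' =>
    change ((β_ (e.eval X) (e'.eval X)).hom ⊗ₘ (β_ (e.eval Y) (e'.eval Y)).hom) ≫
        tensorμ _ _ _ _ ≫ ((evalMul X Y e').hom ⊗ₘ (evalMul X Y e).hom) =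
      (tensorμ _ _ _ _ ≫ ((evalMul X Y e).hom ⊗ₘ (evalMul X Y e').hom)) ≫ (β_ _ _).hom
    rw [Category.assoc, BraidedCategory.braiding_naturality, reassoc_of% tensorμ_comm]

/-- `Canonical i Z η e b f` says that `f` is the canonical isomorphism from the value of `e` at
the family `Z`, all of whose members but `Z i` are trivialized by `η`, to `Z i` if `i` occurs in
`e` (once), in which case `b` is `true`, and to the unit object if `i` does not occur in `e`. -/
inductive Canonical (i : ι) (Z : ι → P) (η : ∀ j, j ≠ i → (Z j ≅ 𝟙_ P)) :
    (e : TensorWord ι) → (b : Bool) → (e.eval Z ≅ cond b (Z i) (𝟙_ P)) → Prop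
  | same : Canonical i Z η (var i) true (Iso.refl _)
  | other (j : ι) (h : j ≠ i) : Canonical i Z η (var j) false (η j h)
  | none {e e'} {f f'} : Canonical i Z η e false f → Canonical i Z η e' false f' →
      Canonical i Z η (mul e e') false ((f ⊗ᵢ f') ≪≫ λ_ (𝟙_ P))
  | left {e e'} {f f'} : Canonical i Z η e true f → Canonical i Z η e' false f' →
      Canonical i Z η (mul e e') true ((f ⊗ᵢ f') ≪≫ ρ_ (Z i))
  | right {e e'} {f f'} : Canonical i Z η e false f → Canonical i Z η e' true f' →
      Canonical i Z η (mul e e') true ((f ⊗ᵢ f') ≪≫ λ_ (Z i))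

namespace Canonical

variable {i : ι} {Z : ι → P} {η : ∀ j, j ≠ i → (Z j ≅ 𝟙_ P)}

omit [SymmetricCategory P] in
lemma count_eq [DecidableEq ι] {e : TensorWord ι} {b : Bool} {f} (h : Canonical i Z η e b f) :
    e.count i = b.toNat := by
  induction h with
  | same => simp [count]
  | other j h => simp [count, h]
  | none _ _ h h' => simp [count, h, h']
  | left _ _ h h' => simp [count, h, h']
  | right _ _ h h' => simp [count, h, h']

omit [SymmetricCategory P] in
lemma exists_of_count_le [DecidableEq ι] (η : ∀ j, j ≠ i → (Z j ≅ 𝟙_ P)) (e : TensorWord ι)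
    (h : e.count i ≤ 1) : ∃ b f, Canonical i Z η e b f := by
  induction e with
  | var j =>
    by_cases hj : j = i
    · subst hj; exact ⟨_, _, .same⟩
    · exact ⟨_, _, .other j hj⟩
  | mul e e' ih ih' =>
    simp only [count] at h
    obtain ⟨b, f, hf⟩ := ih (by omega)
    obtain ⟨b', f', hf'⟩ := ih' (by omega)
    have := hf.count_eq
    have := hf'.count_eq
    cases b <;> cases b'
    · exact ⟨_, _, .none hf hf'⟩
    · exact ⟨_, _, .right hf hf'⟩
    · exact ⟨_, _, .left hf hf'⟩
    · simp at *; omega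

omit [SymmetricCategory P] in
lemma unique {e : TensorWord ι} {b : Bool} {f f'} (h : Canonical i Z η e b f)
    (h' : Canonical i Z η e b f') : f = f' := by
  classical
  induction h with
  | same => cases h' with
    | same => rfl
  | other j h => cases h' with
    | other => rfl
  | none h₁ h₂ ih ih' => cases h' with
    | none k₁ k₂ => rw [ih k₁, ih' k₂]
  | left h₁ h₂ ih ih' => cases h' with
    | left k₁ k₂ => rw [ih k₁, ih' k₂]
    | right k₁ k₂ => simpa [h₁.count_eq] using k₁.count_eq
  | right h₁ h₂ ih ih' => cases h' with
    | right k₁ k₂ => rw [ih k₁, ih' k₂]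
    | left k₁ k₂ => simpa [h₁.count_eq] using k₁.count_eq

omit [SymmetricCategory P] in
lemma of_eq {e : TensorWord ι} {b : Bool} {f f'} (h : Canonical i Z η e b f)
    (h' : f = f') : Canonical i Z η e b f' := h' ▸ h

section

variable {A B C A' B' C' : P}

omit [SymmetricCategory P] in
lemma tensorIso_trans_trans {A'' B'' D : P} (a : A ≅ A') (b : B ≅ B') (a' : A' ≅ A'')
    (b' : B' ≅ B'') (d : A'' ⊗ B'' ≅ D) :
    ((a ≪≫ a') ⊗ᵢ (b ≪≫ b')) ≪≫ d = (a ⊗ᵢ b) ≪≫ (a' ⊗ᵢ b') ≪≫ d := by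
  ext; simp [tensorHom_comp_tensorHom_assoc]

omit [SymmetricCategory P] in
lemma tensorIso_assoc (a : A ≅ A') (b : B ≅ B') (c : C ≅ C') {D D' G : P} {d : A' ⊗ B' ≅ D}
    {k : D ⊗ C' ≅ G} {d' : B' ⊗ C' ≅ D'} {k' : A' ⊗ D' ≅ G}
    (h : d.hom ▷ C' ≫ k.hom = (α_ A' B' C').hom ≫ A' ◁ d'.hom ≫ k'.hom) :
    (α_ A B C).symm ≪≫ (((a ⊗ᵢ b) ≪≫ d) ⊗ᵢ c) ≪≫ k =
      (a ⊗ᵢ ((b ⊗ᵢ c) ≪≫ d')) ≪≫ k' := by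
  ext
  have h₁ : ((a.hom ⊗ₘ b.hom) ≫ d.hom) ⊗ₘ c.hom =
      ((a.hom ⊗ₘ b.hom) ⊗ₘ c.hom) ≫ d.hom ▷ C' := by
    rw [← tensorHom_id, tensorHom_comp_tensorHom, Category.comp_id]
  have h₂ : a.hom ⊗ₘ ((b.hom ⊗ₘ c.hom) ≫ d'.hom) =
      (a.hom ⊗ₘ b.hom ⊗ₘ c.hom) ≫ A' ◁ d'.hom := by
    rw [← id_tensorHom, tensorHom_comp_tensorHom, Category.comp_id]
  simp only [Iso.trans_hom, Iso.symm_hom, tensorIso_hom]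
  rw [h₁, h₂, Category.assoc, h, Iso.inv_comp_eq, associator_naturality_assoc, Category.assoc]

omit [SymmetricCategory P] in
lemma tensorIso_assoc' (a : A ≅ A') (b : B ≅ B') (c : C ≅ C') {D D' G : P} {d : A' ⊗ B' ≅ D}
    {k : D ⊗ C' ≅ G} {d' : B' ⊗ C' ≅ D'} {k' : A' ⊗ D' ≅ G}
    (h : d.hom ▷ C' ≫ k.hom = (α_ A' B' C').hom ≫ A' ◁ d'.hom ≫ k'.hom) :
    α_ A B C ≪≫ (a ⊗ᵢ ((b ⊗ᵢ c) ≪≫ d')) ≪≫ k' =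
      (((a ⊗ᵢ b) ≪≫ d) ⊗ᵢ c) ≪≫ k := by
  rw [← tensorIso_assoc a b c h]
  ext
  simp

lemma tensorIso_comm (a : A ≅ A') (b : B ≅ B') {G : P} {k : A' ⊗ B' ≅ G} {k' : B' ⊗ A' ≅ G}
    (h : (β_ A' B').hom ≫ k'.hom = k.hom) :
    β_ A B ≪≫ (b ⊗ᵢ a) ≪≫ k' = (a ⊗ᵢ b) ≪≫ k := by
  ext
  simp [← h]

lemma tensorIso_comm' (a : A ≅ A') (b : B ≅ B') {G : P} {k : A' ⊗ B' ≅ G} {k' : B' ⊗ A' ≅ G}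
    (h : (β_ A' B').hom ≫ k'.hom = k.hom) :
    (β_ B A).symm ≪≫ (b ⊗ᵢ a) ≪≫ k' = (a ⊗ᵢ b) ≪≫ k := by
  rw [← tensorIso_comm a b h,
    show (β_ B A).symm = β_ A B from
      Iso.ext (SymmetricCategory.braiding_swap_eq_inv_braiding B A).symm]

end

/-- Structural isomorphisms are compatible with the canonical isomorphisms. -/
lemma comp_str {e e' : TensorWord ι} (t : Str e e') (b : Bool) :
    (∀ f, Canonical i Z η e b f → Canonical i Z η e' b ((t.eval Z).symm ≪≫ f)) ∧
      ∀ f, Canonical i Z η e' b f → Canonical i Z η e b (t.eval Z ≪≫ f) := by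
  induction t generalizing b with
  | refl e => exact ⟨fun f h => h.of_eq (by ext; simp [Str.eval]),
      fun f h => h.of_eq (by ext; simp [Str.eval])⟩
  | symm t ih => exact ⟨fun f h => ((ih b).2 f h).of_eq (by ext; simp [Str.eval]),
      fun f h => ((ih b).1 f h).of_eq (by ext; simp [Str.eval])⟩
  | trans t t' ih ih' =>
    exact ⟨fun f h => ((ih' b).1 _ ((ih b).1 f h)).of_eq (by ext; simp [Str.eval]),
      fun f h => ((ih b).2 _ ((ih' b).2 f h)).of_eq (by ext; simp [Str.eval])⟩
  | tensor t t' ih ih' =>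
    constructor
    · intro f h
      cases h with
      | none h h' =>
          exact (Canonical.none ((ih _).1 _ h) ((ih' _).1 _ h')).of_eq
            (tensorIso_trans_trans _ _ _ _ _)
      | left h h' =>
          exact (Canonical.left ((ih _).1 _ h) ((ih' _).1 _ h')).of_eq
            (tensorIso_trans_trans _ _ _ _ _)
      | right h h' =>
          exact (Canonical.right ((ih _).1 _ h) ((ih' _).1 _ h')).of_eq
            (tensorIso_trans_trans _ _ _ _ _)
    · intro f h
      cases h with
      | none h h' =>
          exact (Canonical.none ((ih _).2 _ h) ((ih' _).2 _ h')).of_eq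
            (tensorIso_trans_trans _ _ _ _ _)
      | left h h' =>
          exact (Canonical.left ((ih _).2 _ h) ((ih' _).2 _ h')).of_eq
            (tensorIso_trans_trans _ _ _ _ _)
      | right h h' =>
          exact (Canonical.right ((ih _).2 _ h) ((ih' _).2 _ h')).of_eq
            (tensorIso_trans_trans _ _ _ _ _)
  | assoc e e' e'' =>
    constructor
    · intro f h
      cases h with
      | none h h'' => cases h with
        | none h h' =>
            exact (Canonical.none h (.none h' h'')).of_eq
              (tensorIso_assoc _ _ _ (by monoidal)).symm
      | left h h'' => cases h with
        | left h h' =>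
            exact (Canonical.left h (.none h' h'')).of_eq
              (tensorIso_assoc _ _ _ (by monoidal)).symm
        | right h h' =>
            exact (Canonical.right h (.left h' h'')).of_eq
              (tensorIso_assoc _ _ _ (by monoidal)).symm
      | right h h'' => cases h with
        | none h h' =>
            exact (Canonical.right h (.right h' h'')).of_eq
              (tensorIso_assoc _ _ _ (by monoidal)).symm
    · intro f h
      cases h with
      | none h h'' => cases h'' with
        | none h' h'' =>
            exact (Canonical.none (.none h h') h'').of_eq
              (tensorIso_assoc' _ _ _ (by monoidal)).symm
      | left h h'' => cases h'' with
        | none h' h'' =>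
            exact (Canonical.left (.left h h') h'').of_eq
              (tensorIso_assoc' _ _ _ (by monoidal)).symm
      | right h h'' => cases h'' with
        | left h' h'' =>
            exact (Canonical.left (.right h h') h'').of_eq
              (tensorIso_assoc' _ _ _ (by monoidal)).symm
        | right h' h'' =>
            exact (Canonical.right (.none h h') h'').of_eq
              (tensorIso_assoc' _ _ _ (by monoidal)).symm
  | comm e e' =>
    constructor
    · intro f h
      cases h with
      | none h h' =>
        exact (Canonical.none h' h).of_eq
          (tensorIso_comm' _ _ ((braiding_leftUnitor _).trans unitors_equal.symm)).symm
      | left h h' => exact (Canonical.right h' h).of_eq (tensorIso_comm' _ _ (by simp)).symm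
      | right h h' => exact (Canonical.left h' h).of_eq (tensorIso_comm' _ _ (by simp)).symm
    · intro f h
      cases h with
      | none h h' =>
        exact (Canonical.none h' h).of_eq
          (tensorIso_comm _ _ ((braiding_leftUnitor _).trans unitors_equal.symm)).symm
      | left h h' => exact (Canonical.right h' h).of_eq (tensorIso_comm _ _ (by simp)).symm
      | right h h' => exact (Canonical.left h' h).of_eq (tensorIso_comm _ _ (by simp)).symm

end Canonical

/-- Two structural isomorphisms with the same source and target agree at families of the form
`(𝟙, …, 𝟙, Z, 𝟙, …, 𝟙)`. -/
lemma Str.eval_eq_of_single [DecidableEq ι] (i : ι) (Z : ι → P)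
    (η : ∀ j, j ≠ i → (Z j ≅ 𝟙_ P)) {e e' : TensorWord ι} (t t' : Str e e')
    (h : e.count i ≤ 1) : t.eval Z = t'.eval Z := by
  obtain ⟨b, f, hf⟩ := Canonical.exists_of_count_le η e h
  have := ((Canonical.comp_str t b).1 f hf).unique ((Canonical.comp_str t' b).1 f hf)
  have h2 := congrArg Iso.inv this
  ext; simpa using h2

lemma Str.eval_eq_of_support [DecidableEq ι] {e e' : TensorWord ι} (t t' : Str e e')
    (h : ∀ i, e.count i ≤ 1) (s : Finset ι) :
    ∀ X : ι → P, (∀ i ∉ s, Nonempty (X i ≅ 𝟙_ P)) → t.eval X = t'.eval X := by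
  induction s using Finset.induction_on with
  | empty =>
    intro X hX
    have i : ι := e.rec id fun _ _ i _ => i
    exact Str.eval_eq_of_single i X (fun j _ => (hX j (Finset.notMem_empty j)).some) t t' (h i)
  | insert i s hi ih =>
    intro X hX
    -- `X` is the product of a family supported at `i` and a family supported on `s`.
    let Y : ι → P := Function.update (fun _ => 𝟙_ P) i (X i)
    let Z : ι → P := Function.update X i (𝟙_ P)
    have hY : t.eval Y = t'.eval Y := Str.eval_eq_of_single i Y
      (fun j hj => eqToIso (Function.update_of_ne hj _ _)) t t' (h i)
    have hZ : t.eval Z = t'.eval Z := ih Z fun j hj => by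
      by_cases hji : j = i
      · subst hji; exact ⟨eqToIso (Function.update_self _ _ _)⟩
      · obtain ⟨f⟩ := hX j (by simp [hj, hji])
        exact ⟨eqToIso (Function.update_of_ne hji _ _) ≪≫ f⟩
    have k : ∀ j, (Y j ⊗ Z j ≅ X j) := fun j =>
      if hj : j = i then by
        subst hj
        exact (eqToIso (Function.update_self _ _ _) ⊗ᵢ eqToIso (Function.update_self _ _ _)) ≪≫ ρ_ _
      else (eqToIso (Function.update_of_ne hj _ _) ⊗ᵢ eqToIso (Function.update_of_ne hj _ _)) ≪≫
        λ_ _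
    have h₁ := Str.eval_natural k t
    have h₂ := Str.eval_natural k t'
    have h₃ := Str.eval_mul Y Z t
    have h₄ := Str.eval_mul Y Z t'
    rw [hY, hZ, h₄] at h₃
    ext
    rw [← cancel_epi (evalIso k e).hom, ← h₁, ← h₂, (cancel_epi _).1 h₃]

/-- Coherence: two structural isomorphisms with the same source and target agree if no variable
occurs twice in the source. -/
theorem Str.eval_eq [Fintype ι] [DecidableEq ι] {e e' : TensorWord ι} (t t' : Str e e')
    (h : ∀ i, e.count i ≤ 1) (X : ι → P) : t.eval X = t'.eval X :=
  Str.eval_eq_of_support t t' h Finset.univ X fun i hi => absurd (Finset.mem_univ i) hi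

end TensorWord
end Coherence
end DetFun
namespace DetFun

/-! ### Structural morphisms between decorated objects -/

section Decorations

variable {ι : Type} {P : Type u₃} [Category.{v₃} P] [MonoidalCategory P] [SymmetricCategory P]

namespace TensorWord

/-- For objects `W`, `W'` identified with formal tensor products by `i` and `i'`, the morphism `f`
is structural: it becomes the value of a formal structural isomorphism. -/
def IsStr {X : ι → P} {e e' : TensorWord ι} {W W' : P} (i : W ≅ e.eval X) (i' : W' ≅ e'.eval X)
    (f : W ⟶ W') : Prop :=
  ∃ t : Str e e', f ≫ i'.hom = i.hom ≫ (t.eval X).hom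

/-- A variable, identified with itself. -/
def varIso (X : ι → P) (j : ι) : X j ≅ (var j).eval X := Iso.refl _

/-- The product of two identifications with formal tensor products. -/
def mulIso {X : ι → P} {e e' : TensorWord ι} {W W' : P} (i : W ≅ e.eval X) (i' : W' ≅ e'.eval X) :
    W ⊗ W' ≅ (mul e e').eval X := i ⊗ᵢ i'

namespace IsStr

variable {X : ι → P} {e e' e'' e₁ e₁' : TensorWord ι} {W W' W'' W₁ W₁' : P}
  {i : W ≅ e.eval X} {i' : W' ≅ e'.eval X} {i'' : W'' ≅ e''.eval X}
  {i₁ : W₁ ≅ e₁.eval X} {i₁' : W₁' ≅ e₁'.eval X}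

lemma id : IsStr i i (𝟙 W) := ⟨.refl e, by simp [Str.eval]⟩

lemma comp {f : W ⟶ W'} {g : W' ⟶ W''} (hf : IsStr i i' f) (hg : IsStr i' i'' g) :
    IsStr i i'' (f ≫ g) := by
  obtain ⟨t, ht⟩ := hf
  obtain ⟨t', ht'⟩ := hg
  exact ⟨t.trans t', by simp [Str.eval, ht', reassoc_of% ht]⟩

lemma tensor {f : W ⟶ W'} {g : W₁ ⟶ W₁'} (hf : IsStr i i' f) (hg : IsStr i₁ i₁' g) :
    IsStr (mulIso i i₁) (mulIso i' i₁') (f ⊗ₘ g) := by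
  obtain ⟨t, ht⟩ := hf
  obtain ⟨t', ht'⟩ := hg
  refine ⟨t.tensor t', ?_⟩
  change (f ⊗ₘ g) ≫ (i'.hom ⊗ₘ i₁'.hom) =
    (i.hom ⊗ₘ i₁.hom) ≫ ((t.eval X).hom ⊗ₘ (t'.eval X).hom)
  simp only [tensorHom_comp_tensorHom, ht, ht']

lemma whiskerRight {f : W ⟶ W'} (hf : IsStr i i' f) :
    IsStr (mulIso i i₁) (mulIso i' i₁) (f ▷ W₁) := by
  simpa using hf.tensor (id (i := i₁))

lemma whiskerLeft {f : W ⟶ W'} (hf : IsStr i i' f) :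
    IsStr (mulIso i₁ i) (mulIso i₁ i') (W₁ ◁ f) := by
  simpa using (id (i := i₁)).tensor hf

lemma inv {f : W ⟶ W'} [IsIso f] (hf : IsStr i i' f) : IsStr i' i (CategoryTheory.inv f) := by
  obtain ⟨t, ht⟩ := hf
  refine ⟨t.symm, ?_⟩
  change _ = i'.hom ≫ (t.eval X).inv
  rw [Iso.eq_comp_inv, Category.assoc, ← ht, IsIso.inv_hom_id_assoc]

lemma iso_inv {f : W ≅ W'} (hf : IsStr i i' f.hom) : IsStr i' i f.inv := by
  simpa using hf.inv

lemma assoc_hom : IsStr (mulIso (mulIso i i') i'') (mulIso i (mulIso i' i'')) (α_ W W' W'').hom :=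
  ⟨.assoc e e' e'', (associator_naturality i.hom i'.hom i''.hom).symm⟩

lemma assoc_inv : IsStr (mulIso i (mulIso i' i'')) (mulIso (mulIso i i') i'') (α_ W W' W'').inv :=
  assoc_hom.iso_inv

lemma braid : IsStr (mulIso i i') (mulIso i' i) (β_ W W').hom :=
  ⟨.comm e e', (BraidedCategory.braiding_naturality i.hom i'.hom).symm⟩

lemma tensorμ : IsStr (mulIso (mulIso i i') (mulIso i₁ i₁')) (mulIso (mulIso i i₁) (mulIso i' i₁'))
    (tensorμ W W' W₁ W₁') :=
  assoc_hom.comp ((whiskerLeft assoc_inv).comp ((whiskerLeft (whiskerRight braid)).comp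
    ((whiskerLeft assoc_hom).comp assoc_inv)))

lemma of_comp {f : W ⟶ W'} {g : W' ⟶ W''} [IsIso g] (h : IsStr i i'' (f ≫ g))
    (hg : IsStr i' i'' g) : IsStr i i' f := by
  simpa using h.comp hg.inv

/-- An object may be identified with a formal tensor product through any isomorphism `f` to an
object which is already identified with one; then `f` is structural. -/
lemma of_trans (f : W ≅ W') (i' : W' ≅ e'.eval X) : IsStr (f ≪≫ i') i' f.hom :=
  ⟨.refl e', by simp [Str.eval]⟩

/-- Structural morphisms between the same decorated objects agree if no variable is repeated. -/
lemma eq [Fintype ι] [DecidableEq ι] {f g : W ⟶ W'} (hf : IsStr i i' f) (hg : IsStr i i' g)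
    (h : ∀ j, e.count j ≤ 1) : f = g := by
  obtain ⟨t, ht⟩ := hf
  obtain ⟨t', ht'⟩ := hg
  rw [← cancel_mono i'.hom, ht, ht', Str.eval_eq t t' h X]

end IsStr
end TensorWord
end Decorations

/-! ### Units in Picard categories -/

section Units

variable {P : Type u₃} [Category.{v₃} P] [MonoidalCategory P] [SymmetricCategory P]
  [PicardCategory P]

lemma whiskerRight_cancel (W : P) {X Y : P} {f g : X ⟶ Y} (h : f ▷ W = g ▷ W) : f = g :=
  (tensorRight W).map_injective h

lemma whiskerLeft_cancel (W : P) {X Y : P} {f g : X ⟶ Y} (h : W ◁ f = W ◁ g) : f = g :=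
  haveI := PicardCategory.isEquivalence_tensorLeft W
  (tensorLeft W).map_injective h

instance (priority := 50) isIso_of_picard {X Y : P} (f : X ⟶ Y) : IsIso f :=
  IsGroupoid.all_isIso f

/-- The isomorphism `𝟙 ⟶ U` determined by a unit structure `δ : U ≅ U ⊗ U`. -/
noncomputable def UnitStr.ε {U : P} (δ : UnitStr U) : 𝟙_ P ⟶ U :=
  (tensorRight U).preimage ((λ_ U).hom ≫ δ.hom)

lemma UnitStr.ε_whiskerRight {U : P} (δ : UnitStr U) : δ.ε ▷ U = (λ_ U).hom ≫ δ.hom :=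
  (tensorRight U).map_preimage _

lemma UnitStr.eq_ε {U : P} (δ : UnitStr U) {f : 𝟙_ P ⟶ U} (h : f ▷ U = (λ_ U).hom ≫ δ.hom) :
    f = δ.ε :=
  whiskerRight_cancel U (h.trans δ.ε_whiskerRight.symm)

lemma UnitStr.ρ_whiskerRight {U : P} (δ : UnitStr U) (X : P) :
    (δ.ρ X).hom ▷ U = X ◁ δ.hom ≫ (α_ X U U).inv :=
  (tensorRight U).map_preimage _

lemma UnitStr.ρ_eq {U : P} (δ : UnitStr U) (X : P) :
    (δ.ρ X).hom = (ρ_ X).inv ≫ X ◁ δ.ε := by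
  apply whiskerRight_cancel U
  have : (X ◁ δ.ε) ▷ U = (α_ X (𝟙_ P) U).hom ≫ X ◁ (δ.ε ▷ U) ≫ (α_ X U U).inv := by simp
  rw [δ.ρ_whiskerRight, comp_whiskerRight, this, δ.ε_whiskerRight]
  simp

/-- Morphisms of units are the morphisms compatible with the trivializations `ε`. -/
lemma isUnitHom_iff {U U' : P} (δ : UnitStr U) (δ' : UnitStr U') (a : U ⟶ U') :
    IsUnitHom δ δ' a ↔ δ.ε ≫ a = δ'.ε := by
  have h : 𝟙_ P ◁ a ≫ (δ.ε ≫ a) ▷ U' = (λ_ U).hom ≫ δ.hom ≫ (a ⊗ₘ a) := by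
    rw [← Category.assoc, ← δ.ε_whiskerRight, MonoidalCategory.tensorHom_def', comp_whiskerRight,
      ← whisker_exchange_assoc]
  have h' : 𝟙_ P ◁ a ≫ δ'.ε ▷ U' = (λ_ U).hom ≫ a ≫ δ'.hom := by
    rw [δ'.ε_whiskerRight]; simp
  constructor
  · intro H
    refine whiskerRight_cancel U' ((cancel_epi (𝟙_ P ◁ a)).1 ?_)
    rw [h, h', H]
  · intro H
    refine (cancel_epi (λ_ U).hom).1 ?_
    rw [← h, ← h', H]

omit [PicardCategory P] in
open TensorWord in
lemma tensorμ_tensorμ (X₁ X₂ Y₁ Y₂ : P) :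
    tensorμ X₁ X₂ Y₁ Y₂ ≫ tensorμ X₁ Y₁ X₂ Y₂ = 𝟙 _ := by
  let X : Fin 4 → P := ![X₁, X₂, Y₁, Y₂]
  exact (IsStr.tensorμ.comp IsStr.tensorμ).eq
    (i := mulIso (mulIso (varIso X 0) (varIso X 1)) (mulIso (varIso X 2) (varIso X 3)))
    IsStr.id (by decide)

lemma UnitStr.prod_ε {U U' : P} (δ : UnitStr U) (δ' : UnitStr U') :
    (δ.prod δ').ε = (λ_ (𝟙_ P)).inv ≫ (δ.ε ⊗ₘ δ'.ε) := by
  refine (UnitStr.eq_ε _ ?_).symm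
  change _ = _ ≫ (δ.hom ⊗ₘ δ'.hom) ≫ tensorμ U U U' U'
  rw [← cancel_mono (tensorμ U U' U U'), comp_whiskerRight, Category.assoc,
    tensorμ_natural_left δ.ε δ'.ε U U', δ.ε_whiskerRight, δ'.ε_whiskerRight,
    ← tensorHom_comp_tensorHom, Category.assoc, Category.assoc, tensorμ_tensorμ,
    Category.comp_id, tensor_left_unitality]
  simp only [Category.assoc]

end Units

/-! ### Splicing three short exact sequences -/

section Splice

open TensorWord

variable {P : Type u₃} [Category.{v₃} P] [MonoidalCategory P] [SymmetricCategory P]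
  [PicardCategory P]

/-- The part of `splice` following the introduction of the unit `K ⊗ K'`. -/
def splicePure {K K' L M A B C : P} (s₁ : B ≅ L ⊗ M) (s₂ : A ≅ K ⊗ L) (s₃ : C ≅ M ⊗ K') :
    B ⊗ (K ⊗ K') ⟶ A ⊗ C :=
  s₁.hom ▷ (K ⊗ K') ≫ tensorμ L M K K' ≫ (β_ L K).hom ▷ (M ⊗ K') ≫ (s₂.inv ⊗ₘ s₃.inv)

/-- The isomorphism `B ≅ A ⊗ C` obtained from `B ≅ L ⊗ M`, `A ≅ K ⊗ L`, `C ≅ M ⊗ K'` and a unit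
structure on `K ⊗ K'`. -/
noncomputable def splice {K K' L M A B C : P} (δ : UnitStr (K ⊗ K')) (s₁ : B ≅ L ⊗ M)
    (s₂ : A ≅ K ⊗ L) (s₃ : C ≅ M ⊗ K') : B ≅ A ⊗ C :=
  δ.ρ B ≪≫ whiskerRightIso s₁ (K ⊗ K') ≪≫ midSwap L M K K' ≪≫
    whiskerRightIso (β_ L K) (M ⊗ K') ≪≫ (s₂.symm ⊗ᵢ s₃.symm)

lemma splice_hom {K K' L M A B C : P} (δ : UnitStr (K ⊗ K')) (s₁ : B ≅ L ⊗ M)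
    (s₂ : A ≅ K ⊗ L) (s₃ : C ≅ M ⊗ K') :
    (splice δ s₁ s₂ s₃).hom = (ρ_ B).inv ≫ B ◁ δ.ε ≫ splicePure s₁ s₂ s₃ := by
  rw [← Category.assoc, ← δ.ρ_eq]
  rfl

/-- Splicing is natural. -/
lemma splice_natural {K K' L M A B C K₁ K₁' L₁ M₁ A₁ B₁ C₁ : P} {δ : UnitStr (K ⊗ K')}
    {s₁ : B ≅ L ⊗ M} {s₂ : A ≅ K ⊗ L} {s₃ : C ≅ M ⊗ K'} {δ' : UnitStr (K₁ ⊗ K₁')}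
    {s₁' : B₁ ≅ L₁ ⊗ M₁} {s₂' : A₁ ≅ K₁ ⊗ L₁} {s₃' : C₁ ≅ M₁ ⊗ K₁'}
    {k : K ⟶ K₁} {k' : K' ⟶ K₁'} {l : L ⟶ L₁} {m : M ⟶ M₁} {a : A ⟶ A₁} {b : B ⟶ B₁} {c : C ⟶ C₁}
    (hδ : IsUnitHom δ δ' (k ⊗ₘ k')) (h₁ : s₁.hom ≫ (l ⊗ₘ m) = b ≫ s₁'.hom)
    (h₂ : s₂.hom ≫ (k ⊗ₘ l) = a ≫ s₂'.hom) (h₃ : s₃.hom ≫ (m ⊗ₘ k') = c ≫ s₃'.hom) :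
    (splice δ s₁ s₂ s₃).hom ≫ (a ⊗ₘ c) = b ≫ (splice δ' s₁' s₂' s₃').hom := by
  rw [isUnitHom_iff] at hδ
  have h₂' : s₂.inv ≫ a = (k ⊗ₘ l) ≫ s₂'.inv := by
    rw [Iso.inv_comp_eq, reassoc_of% h₂, Iso.hom_inv_id, Category.comp_id]
  have h₃' : s₃.inv ≫ c = (m ⊗ₘ k') ≫ s₃'.inv := by
    rw [Iso.inv_comp_eq, reassoc_of% h₃, Iso.hom_inv_id, Category.comp_id]
  rw [splice_hom, splice_hom, splicePure, splicePure]
  simp only [Category.assoc]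
  rw [tensorHom_comp_tensorHom, h₂', h₃', ← tensorHom_comp_tensorHom]
  have e₁ : (β_ L K).hom ▷ (M ⊗ K') ≫ ((k ⊗ₘ l) ⊗ₘ (m ⊗ₘ k')) =
      ((l ⊗ₘ k) ⊗ₘ (m ⊗ₘ k')) ≫ (β_ L₁ K₁).hom ▷ (M₁ ⊗ K₁') := by
    rw [← tensorHom_id, ← tensorHom_id, tensorHom_comp_tensorHom, tensorHom_comp_tensorHom]
    simp
  have e₂ : s₁.hom ▷ (K ⊗ K') ≫ ((l ⊗ₘ m) ⊗ₘ (k ⊗ₘ k')) =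
      (b ⊗ₘ (k ⊗ₘ k')) ≫ s₁'.hom ▷ (K₁ ⊗ K₁') := by
    rw [← tensorHom_id, ← tensorHom_id, tensorHom_comp_tensorHom, tensorHom_comp_tensorHom, h₁]
    simp
  have e₃ : B ◁ δ.ε ≫ (b ⊗ₘ (k ⊗ₘ k')) = b ▷ 𝟙_ P ≫ B₁ ◁ δ'.ε := by
    rw [← hδ, ← id_tensorHom, tensorHom_comp_tensorHom, MonoidalCategory.tensorHom_def]
    simp
  rw [reassoc_of% e₁, ← tensorμ_natural_assoc, reassoc_of% e₂, reassoc_of% e₃]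
  simp

omit [PicardCategory P] in
lemma splicePure_isStr {ι : Type} {X : ι → P} {K K' L M A B C : P} {s₁ : B ≅ L ⊗ M}
    {s₂ : A ≅ K ⊗ L} {s₃ : C ≅ M ⊗ K'} {eK eK' eL eM eA eB eC : TensorWord ι}
    {iK : K ≅ eK.eval X} {iK' : K' ≅ eK'.eval X} {iL : L ≅ eL.eval X} {iM : M ≅ eM.eval X}
    {iA : A ≅ eA.eval X} {iB : B ≅ eB.eval X} {iC : C ≅ eC.eval X}
    (h₁ : IsStr iB (mulIso iL iM) s₁.hom) (h₂ : IsStr iA (mulIso iK iL) s₂.hom)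
    (h₃ : IsStr iC (mulIso iM iK') s₃.hom) :
    IsStr (mulIso iB (mulIso iK iK')) (mulIso iA iC) (splicePure s₁ s₂ s₃) :=
  h₁.whiskerRight.comp (IsStr.tensorμ.comp (IsStr.braid.whiskerRight.comp
    (h₂.iso_inv.tensor h₃.iso_inv)))

omit [SymmetricCategory P] [PicardCategory P] in
/-- Two successive introductions of units amount to the introduction of their product. -/
lemma introduce_units {C D G U V : P} (f : 𝟙_ P ⟶ U) (g : 𝟙_ P ⟶ V) (p : C ⊗ U ⟶ D)
    (q : D ⊗ V ⟶ G) :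
    ((ρ_ C).inv ≫ C ◁ f ≫ p) ≫ (ρ_ D).inv ≫ D ◁ g ≫ q =
      (ρ_ C).inv ≫ C ◁ ((λ_ _).inv ≫ (f ⊗ₘ g)) ≫ (α_ _ _ _).inv ≫ p ▷ V ≫ q := by
  have h : (ρ_ C).inv ≫ C ◁ ((λ_ _).inv ≫ (f ⊗ₘ g)) ≫ (α_ _ _ _).inv =
      (ρ_ C).inv ≫ C ◁ f ≫ (ρ_ _).inv ≫ (C ⊗ U) ◁ g := by
    rw [MonoidalCategory.tensorHom_def, unitors_inv_equal]
    simp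
  rw [reassoc_of% h, whisker_exchange_assoc]
  simp

omit [PicardCategory P] in
/-- A unit introduced to the right of `B` may be introduced to the right of `B ⊗ A`. -/
lemma introduce_unit_whiskerRight (A B : P) {U : P} (f : 𝟙_ P ⟶ U) :
    ((ρ_ B).inv ≫ B ◁ f) ▷ A = (ρ_ (B ⊗ A)).inv ≫ (B ⊗ A) ◁ f ≫
      (α_ _ _ _).hom ≫ B ◁ (β_ _ _).hom ≫ (α_ _ _ _).inv := by
  have h : (B ⊗ A) ◁ f ≫ (α_ _ _ _).hom ≫ B ◁ (β_ _ _).hom =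
      (α_ _ _ _).hom ≫ B ◁ (β_ _ _).hom ≫ B ◁ (f ▷ A) := by
    rw [← whiskerLeft_comp, ← BraidedCategory.braiding_naturality_right, whiskerLeft_comp]
    simp
  rw [reassoc_of% h]
  simp

/-- The associativity axiom for isomorphisms obtained by splicing. The objects `X₁`, …, `X₆` and
`Y₁`, `Y₂`, `Y₄` stand for the determinants of the elementary pieces of an octahedron and their
translates. -/
theorem splice_octahedron {A B C A' B' C' X₁ X₂ X₃ X₄ X₅ X₆ Y₁ Y₂ Y₄ Ku Lu Kb Kc Lc Kx Kp Kg Kz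
      Kw : P}
    -- the short exact sequences belonging to the four triangles
    {sB : B ≅ Kb ⊗ Kx} {sA : A ≅ X₁ ⊗ Kb} {sC' : C' ≅ Kx ⊗ Y₁}
    {tC : C ≅ X₃ ⊗ Kz} {tA : A ≅ Ku ⊗ X₃} {tB' : B' ≅ Kz ⊗ Lu}
    {rC : C ≅ Kp ⊗ X₆} {rB : B ≅ Kc ⊗ Kp} {rA' : A' ≅ X₆ ⊗ Lc}
    {qB' : B' ≅ Kg ⊗ Kw} {qC' : C' ≅ X₄ ⊗ Kg} {qA' : A' ≅ Kw ⊗ Y₄}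
    -- the short exact sequences decomposing the kernels
    {ku : Ku ≅ X₁ ⊗ X₂} {lu : Lu ≅ Y₁ ⊗ Y₂} {kb : Kb ≅ X₂ ⊗ X₃} {kc : Kc ≅ X₂ ⊗ X₄}
    {lc : Lc ≅ Y₂ ⊗ Y₄} {kx : Kx ≅ X₄ ⊗ X₅} {kp : Kp ≅ X₃ ⊗ X₅} {kg : Kg ≅ X₅ ⊗ Y₁}
    {kz : Kz ≅ X₅ ⊗ X₆} {kw : Kw ≅ X₆ ⊗ Y₂}
    (hA : tA.hom ≫ ku.hom ▷ X₃ = sA.hom ≫ X₁ ◁ kb.hom ≫ (α_ _ _ _).inv)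
    (hC' : sC'.hom ≫ kx.hom ▷ Y₁ = qC'.hom ≫ X₄ ◁ kg.hom ≫ (α_ _ _ _).inv)
    (hA' : qA'.hom ≫ kw.hom ▷ Y₄ = rA'.hom ≫ X₆ ◁ lc.hom ≫ (α_ _ _ _).inv)
    (hC : rC.hom ≫ kp.hom ▷ X₆ = tC.hom ≫ X₃ ◁ kz.hom ≫ (α_ _ _ _).inv)
    (hB : sB.hom ≫ (kb.hom ⊗ₘ kx.hom) ≫ tensorμ _ _ _ _ = rB.hom ≫ (kc.hom ⊗ₘ kp.hom))
    (hB' : qB'.hom ≫ (kg.hom ⊗ₘ kw.hom) ≫ tensorμ _ _ _ _ = tB'.hom ≫ (kz.hom ⊗ₘ lu.hom))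
    {δ₁ : UnitStr (X₁ ⊗ Y₁)} {δ₂ : UnitStr (X₂ ⊗ Y₂)} {δ₄ : UnitStr (X₄ ⊗ Y₄)}
    {δu : UnitStr (Ku ⊗ Lu)} {δc : UnitStr (Kc ⊗ Lc)}
    (hu : IsUnitHom δu (δ₁.prod δ₂) ((ku.hom ⊗ₘ lu.hom) ≫ tensorμ _ _ _ _))
    (hc : IsUnitHom δc (δ₂.prod δ₄) ((kc.hom ⊗ₘ lc.hom) ≫ tensorμ _ _ _ _)) :
    (splice δc rC rB rA').hom ≫ (splice δ₁ sB sA sC').hom ▷ A' =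
      (splice δu tC tA tB').hom ≫ A ◁ (splice δ₄ qB' qC' qA').hom ≫ (α_ _ _ _).inv := by
  rw [isUnitHom_iff, UnitStr.prod_ε] at hu hc
  -- The rearrangement of units, and what remains after all units have been introduced.
  let τ : (Kc ⊗ Lc) ⊗ (X₁ ⊗ Y₁) ⟶ (Ku ⊗ Lu) ⊗ (X₄ ⊗ Y₄) :=
    ((kc.hom ⊗ₘ lc.hom) ≫ tensorμ _ _ _ _) ▷ _ ≫ (β_ _ _).hom ≫ (α_ _ _ _).inv ≫
      (inv ((ku.hom ⊗ₘ lu.hom) ≫ tensorμ _ _ _ _)) ▷ _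
  let sL : (C ⊗ (Kc ⊗ Lc)) ⊗ (X₁ ⊗ Y₁) ⟶ (A ⊗ C') ⊗ A' :=
    splicePure rC rB rA' ▷ _ ≫ (α_ _ _ _).hom ≫ B ◁ (β_ _ _).hom ≫ (α_ _ _ _).inv ≫
      splicePure sB sA sC' ▷ A'
  let sR : (C ⊗ (Ku ⊗ Lu)) ⊗ (X₄ ⊗ Y₄) ⟶ (A ⊗ C') ⊗ A' :=
    splicePure tC tA tB' ▷ _ ≫ (α_ _ _ _).hom ≫ A ◁ splicePure qB' qC' qA' ≫ (α_ _ _ _).inv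
  have hL : (splice δc rC rB rA').hom ≫ (splice δ₁ sB sA sC').hom ▷ A' =
      (ρ_ C).inv ≫ C ◁ ((λ_ _).inv ≫ (δc.ε ⊗ₘ δ₁.ε)) ≫ (α_ _ _ _).inv ≫ sL := by
    rw [splice_hom, splice_hom, ← Category.assoc (ρ_ B).inv, comp_whiskerRight,
      introduce_unit_whiskerRight, ← introduce_units]
    simp only [Category.assoc]
  have hR : (splice δu tC tA tB').hom ≫ A ◁ (splice δ₄ qB' qC' qA').hom ≫ (α_ _ _ _).inv =
      (ρ_ C).inv ≫ C ◁ ((λ_ _).inv ≫ (δu.ε ⊗ₘ δ₄.ε)) ≫ (α_ _ _ _).inv ≫ sR := by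
    rw [splice_hom, splice_hom, ← introduce_units]
    simp
  have hτ : ((λ_ _).inv ≫ (δc.ε ⊗ₘ δ₁.ε)) ≫ τ = (λ_ _).inv ≫ (δu.ε ⊗ₘ δ₄.ε) := by
    have h₁ : (δc.ε ⊗ₘ δ₁.ε) ≫ ((kc.hom ⊗ₘ lc.hom) ≫ tensorμ _ _ _ _) ▷ _ =
        ((λ_ _).inv ≫ (δ₂.ε ⊗ₘ δ₄.ε)) ⊗ₘ δ₁.ε := by
      rw [← hc, ← tensorHom_id, tensorHom_comp_tensorHom, Category.comp_id]
    have h₂ : δu.ε = ((λ_ _).inv ≫ (δ₁.ε ⊗ₘ δ₂.ε)) ≫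
        inv ((ku.hom ⊗ₘ lu.hom) ≫ tensorμ _ _ _ _) := by
      rw [← hu, Category.assoc, IsIso.hom_inv_id, Category.comp_id]
    have h₃ : (δ₁.ε ⊗ₘ ((λ_ _).inv ≫ (δ₂.ε ⊗ₘ δ₄.ε))) ≫ (α_ _ _ _).inv =
        ((λ_ _).inv ≫ (δ₁.ε ⊗ₘ δ₂.ε)) ⊗ₘ δ₄.ε := by
      simp only [MonoidalCategory.tensorHom_def]
      rw [unitors_inv_equal]
      simp
    simp only [τ, Category.assoc]
    rw [reassoc_of% h₁, BraidedCategory.braiding_naturality_assoc, reassoc_of% h₃, h₂,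
      ← tensorHom_id, tensorHom_comp_tensorHom, Category.comp_id]
    have h₄ : (β_ (𝟙_ P) (𝟙_ P)).hom = 𝟙 _ := by
      rw [← cancel_mono (λ_ (𝟙_ P)).hom, braiding_leftUnitor, unitors_equal, Category.id_comp]
    rw [h₄, Category.id_comp]
  have hs : (α_ _ _ _).inv ≫ sL = C ◁ τ ≫ (α_ _ _ _).inv ≫ sR := by
    -- Each object is decorated through one of its two decompositions; the hypotheses say that the
    -- other decomposition is structural as well.
    let X : Fin 9 → P := ![X₁, X₂, X₃, X₄, X₅, X₆, Y₁, Y₂, Y₄]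
    let i₁ : X₁ ≅ _ := varIso X 0
    let i₂ : X₂ ≅ _ := varIso X 1
    let i₃ : X₃ ≅ _ := varIso X 2
    let i₄ : X₄ ≅ _ := varIso X 3
    let i₅ : X₅ ≅ _ := varIso X 4
    let i₆ : X₆ ≅ _ := varIso X 5
    let j₁ : Y₁ ≅ _ := varIso X 6
    let j₂ : Y₂ ≅ _ := varIso X 7
    let j₄ : Y₄ ≅ _ := varIso X 8
    have hku := IsStr.of_trans ku (mulIso i₁ i₂)
    have hlu := IsStr.of_trans lu (mulIso j₁ j₂)
    have hkb := IsStr.of_trans kb (mulIso i₂ i₃)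
    have hkc := IsStr.of_trans kc (mulIso i₂ i₄)
    have hlc := IsStr.of_trans lc (mulIso j₂ j₄)
    have hkx := IsStr.of_trans kx (mulIso i₄ i₅)
    have hkp := IsStr.of_trans kp (mulIso i₃ i₅)
    have hkg := IsStr.of_trans kg (mulIso i₅ j₁)
    have hkz := IsStr.of_trans kz (mulIso i₅ i₆)
    have hkw := IsStr.of_trans kw (mulIso i₆ j₂)
    have hsB := IsStr.of_trans sB (mulIso (kb ≪≫ mulIso i₂ i₃) (kx ≪≫ mulIso i₄ i₅))
    have hqB' := IsStr.of_trans qB' (mulIso (kg ≪≫ mulIso i₅ j₁) (kw ≪≫ mulIso i₆ j₂))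
    have hsA := IsStr.of_trans sA (mulIso i₁ (kb ≪≫ mulIso i₂ i₃))
    have hqC' := IsStr.of_trans qC' (mulIso i₄ (kg ≪≫ mulIso i₅ j₁))
    have hrA' := IsStr.of_trans rA' (mulIso i₆ (lc ≪≫ mulIso j₂ j₄))
    have htC := IsStr.of_trans tC (mulIso i₃ (kz ≪≫ mulIso i₅ i₆))
    have htA := IsStr.of_comp (hA ▸ hsA.comp (hkb.whiskerLeft.comp IsStr.assoc_inv))
      (hku.whiskerRight (i₁ := i₃))
    have hsC' := IsStr.of_comp (hC' ▸ hqC'.comp (hkg.whiskerLeft.comp IsStr.assoc_inv))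
      (hkx.whiskerRight (i₁ := j₁))
    have hqA' := IsStr.of_comp (hA' ▸ hrA'.comp (hlc.whiskerLeft.comp IsStr.assoc_inv))
      (hkw.whiskerRight (i₁ := j₄))
    have hrC := IsStr.of_comp (hC ▸ htC.comp (hkz.whiskerLeft.comp IsStr.assoc_inv))
      (hkp.whiskerRight (i₁ := i₆))
    have hrB := IsStr.of_comp (hB ▸ hsB.comp ((hkb.tensor hkx).comp IsStr.tensorμ))
      (hkc.tensor hkp)
    have htB' := IsStr.of_comp (hB' ▸ hqB'.comp ((hkg.tensor hkw).comp IsStr.tensorμ))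
      (hkz.tensor hlu)
    have hτ' := ((hkc.tensor hlc).comp IsStr.tensorμ).whiskerRight.comp (IsStr.braid.comp
      ((IsStr.assoc_inv (i := mulIso i₁ j₁)).comp
        ((hku.tensor hlu).comp IsStr.tensorμ).inv.whiskerRight))
    have hL' := IsStr.assoc_inv.comp ((splicePure_isStr hrC hrB hrA').whiskerRight.comp
      (IsStr.assoc_hom.comp (IsStr.braid.whiskerLeft.comp
        (IsStr.assoc_inv.comp (splicePure_isStr hsB hsA hsC').whiskerRight))))
    have hR' := hτ'.whiskerLeft.comp (IsStr.assoc_inv.comp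
      ((splicePure_isStr htC htA htB').whiskerRight.comp
      (IsStr.assoc_hom.comp ((splicePure_isStr hqB' hqC' hqA').whiskerLeft.comp
        IsStr.assoc_inv))))
    exact hL'.eq hR' (by decide)
  rw [hL, hR, hs, ← hτ]
  simp

end Splice
end DetFun
namespace DetFun

/-! ### Kernels and short exact sequences of bounded graded objects -/

section Graded

variable {E : Type u₂} [Category.{v₂} E] [Abelian E]

/-- `k` is degreewise a kernel of `φ`. -/
structure GrB.IsKer {K X Y : GrB E} (k : K ⟶ X) (φ : X ⟶ Y) : Prop where
  mono : ∀ i, Mono (k.hom i)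
  zero : ∀ i, k.hom i ≫ φ.hom i = 0
  exists_lift : ∀ i {W : E} (x : W ⟶ X.obj i), x ≫ φ.hom i = 0 → ∃ y, y ≫ k.hom i = x

namespace GrB

omit [Abelian E] in
lemma hom_ext {X Y : GrB E} {f g : X ⟶ Y} (h : ∀ i, f.hom i = g.hom i) : f = g := by
  ext i; exact h i

lemma IsKer.cancel {K X Y W : GrB E} {k : K ⟶ X} {φ : X ⟶ Y} (h : IsKer k φ) {x y : W ⟶ K}
    (hxy : x ≫ k = y ≫ k) : x = y :=
  hom_ext fun i => by
    have := h.mono i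
    exact (cancel_mono (k.hom i)).1 (congrArg (fun f => f.hom i) hxy)

lemma IsKer.exists_hom {K X Y W : GrB E} {k : K ⟶ X} {φ : X ⟶ Y} (h : IsKer k φ) (x : W ⟶ X)
    (hx : x ≫ φ = 0) : ∃ y : W ⟶ K, y ≫ k = x := by
  choose y hy using fun i => h.exists_lift i (x.hom i) (congrArg (fun f => f.hom i) hx)
  exact ⟨ObjectProperty.homMk y, hom_ext hy⟩

lemma isKer_kerι {X Y : GrB E} (φ : X ⟶ Y) : IsKer (kerι φ) φ where
  mono i := inferInstanceAs (Mono (kernel.ι (φ.hom i)))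
  zero i := kernel.condition (φ.hom i)
  exists_lift i _ x hx := ⟨kernel.lift (φ.hom i) x hx, kernel.lift_ι _ _ _⟩

lemma kerι_comp {X Y : GrB E} (φ : X ⟶ Y) : kerι φ ≫ φ = 0 :=
  hom_ext (isKer_kerι φ).zero

lemma kerLift_kerι {A B C : GrB E} (a : A ⟶ B) (b : B ⟶ C) (w : ∀ i, a.hom i ≫ b.hom i = 0) :
    kerLift a b w ≫ kerι b = a :=
  hom_ext fun _ => kernel.lift_ι _ _ _

lemma IsKer.map_T {K X Y : GrB E} {k : K ⟶ X} {φ : X ⟶ Y} (h : IsKer k φ) :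
    IsKer ((GrB.T E).map k) ((GrB.T E).map φ) where
  mono i := h.mono (i + 1)
  zero i := h.zero (i + 1)
  exists_lift i := h.exists_lift (i + 1)

lemma ses_of_isKer {S : ShortComplex (GrB E)} (h : IsKer S.f S.g) (he : ∀ i, Epi (S.g.hom i)) :
    ses E S := fun i => by
  have : Mono (S.map (GrB.ev E i)).f := h.mono i
  have : Epi (S.map (GrB.ev E i)).g := he i
  refine ShortComplex.ShortExact.mk' ?_ ‹_› ‹_›
  refine ShortComplex.exact_of_f_is_kernel _ (KernelFork.IsLimit.ofι' _ _ fun {W} s hs => ?_)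
  exact ⟨(h.exists_lift i s hs).choose, (h.exists_lift i s hs).choose_spec⟩

lemma isKer_of_ses {S : ShortComplex (GrB E)} (h : ses E S) : IsKer S.f S.g where
  mono i := (h i).mono_f
  zero i := (S.map (GrB.ev E i)).zero
  exists_lift i _ x hx := by
    have := (h i).mono_f
    exact ⟨(h i).exact.lift x hx, (h i).exact.lift_f x hx⟩

lemma epi_of_ses {S : ShortComplex (GrB E)} (h : ses E S) (i : ℤ) : Epi (S.g.hom i) :=
  (h i).epi_g

lemma cancel_epi_of_ses {S : ShortComplex (GrB E)} (h : ses E S) {W : GrB E} {x y : S.X₃ ⟶ W}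
    (hxy : S.g ≫ x = S.g ≫ y) : x = y :=
  hom_ext fun i => by
    have := epi_of_ses h i
    exact (cancel_epi (S.g.hom i)).1 (congrArg (fun f => f.hom i) hxy)

lemma ses_of_ses_map_T {S : ShortComplex (GrB E)} (h : ses E (S.map (GrB.T E))) : ses E S :=
  fun i => by
    obtain ⟨j, rfl⟩ : ∃ j, i = j + 1 := ⟨i - 1, by omega⟩
    exact h j

lemma ExactAt.epi_kerLift {A B C : GrB E} {a : A ⟶ B} {b : B ⟶ C} (h : ExactAt a b) (i : ℤ) :
    Epi ((kerLift a b h.w).hom i) :=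
  (h i).2.epi_kernelLift

lemma ExactAt.comp_eq_zero {A B C : GrB E} {a : A ⟶ B} {b : B ⟶ C} (h : ExactAt a b) :
    a ≫ b = 0 := hom_ext h.w

/-- The restriction to kernels of the morphisms in a composite `X ⟶ Y ⟶ Z`, together with exact
sequences `X ⟶ Y ⟶ Y'` and `X ⟶ Z ⟶ Z'`, gives two short exact sequences, which decompose
`ker (X ⟶ Z)` and `ker (Y ⟶ Y')`. The common piece `M` is the kernel of `ker (Y ⟶ Y') ⟶ Z`. -/
lemma ses_kernels {X Y Y' Z Z' M : GrB E} {a : X ⟶ Y} {v : Y ⟶ Y'} {r : Y ⟶ Z}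
    {q : X ⟶ Z} {s : Z ⟶ Z'} (hq : a ≫ r = q) (hav : ExactAt a v) (hqs : ExactAt q s)
    {m : M ⟶ ker v} (hm : IsKer m (kerι v ≫ r)) {α : ker a ⟶ ker q} {β : ker q ⟶ M}
    {γ : ker v ⟶ ker s} (hα : α ≫ kerι q = kerι a)
    (hβ : β ≫ m = kerι q ≫ kerLift a v hav.w) (hγ : γ ≫ kerι s = kerι v ≫ r) :
    ∃ (z₁ : α ≫ β = 0) (z₂ : m ≫ γ = 0), ses E (.mk α β z₁) ∧ ses E (.mk m γ z₂) := by
  have kv := isKer_kerι v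
  have kq := isKer_kerι q
  have ks := isKer_kerι s
  have hβ' : β ≫ m ≫ kerι v = kerι q ≫ a := by
    rw [← Category.assoc, hβ, Category.assoc, kerLift_kerι]
  have hγ' : kerLift a v hav.w ≫ γ = kerLift q s hqs.w := by
    refine ks.cancel ?_
    rw [Category.assoc, hγ, ← Category.assoc, kerLift_kerι, kerLift_kerι, hq]
  have z₁ : α ≫ β = 0 := by
    refine hm.cancel (kv.cancel ?_)
    rw [Category.assoc, Category.assoc, hβ', ← Category.assoc, hα, kerι_comp, zero_comp, zero_comp]
  have z₂ : m ≫ γ = 0 := by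
    refine ks.cancel ?_
    rw [Category.assoc, hγ, zero_comp]
    exact hom_ext hm.zero
  refine ⟨z₁, z₂, ses_of_isKer ⟨fun i => ?_, fun i => ?_, fun i W x hx => ?_⟩ fun i => ?_,
    ses_of_isKer ⟨hm.mono, fun i => ?_, fun i W x hx => ?_⟩ fun i => ?_⟩
  · have h : α.hom i ≫ (kerι q).hom i = (kerι a).hom i := congrArg (fun f => f.hom i) hα
    have := (isKer_kerι a).mono i
    exact mono_of_mono_fac h
  · exact congrArg (fun f => f.hom i) z₁
  · have h : β.hom i ≫ m.hom i ≫ (kerι v).hom i = (kerι q).hom i ≫ a.hom i :=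
      congrArg (fun f => f.hom i) hβ'
    obtain ⟨y, hy⟩ := (isKer_kerι a).exists_lift i (x ≫ (kerι q).hom i) (by
      have hx' : x ≫ β.hom i = 0 := hx
      rw [Category.assoc, ← h, reassoc_of% hx', zero_comp])
    refine ⟨y, ?_⟩
    have := kq.mono i
    rw [← cancel_mono ((kerι q).hom i), ← hy, ← hα]
    exact Category.assoc _ _ _
  · -- `ker q` is the pullback of `X ⟶ ker v ⟵ M`, and `X ⟶ ker v` is an epimorphism.
    have := hav.epi_kerLift i
    have h : β.hom i ≫ m.hom i = (kerι q).hom i ≫ (kerLift a v hav.w).hom i :=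
      congrArg (fun f => f.hom i) hβ
    have hl : (kerLift a v hav.w).hom i ≫ (kerι v).hom i = a.hom i :=
      congrArg (fun f => f.hom i) (kerLift_kerι a v hav.w)
    have hq' : a.hom i ≫ r.hom i = q.hom i := congrArg (fun f => f.hom i) hq
    have hm₀ : m.hom i ≫ (kerι v).hom i ≫ r.hom i = 0 := hm.zero i
    rw [epi_iff_surjective_up_to_refinements]
    intro W y
    obtain ⟨W', π, hπ, x, hx⟩ := surjective_up_to_refinements_of_epi
      ((kerLift a v hav.w).hom i) (y ≫ m.hom i)
    obtain ⟨x', hx'⟩ := kq.exists_lift i x (by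
      rw [← hq', ← hl, Category.assoc, ← reassoc_of% hx, hm₀, comp_zero, comp_zero])
    refine ⟨W', π, hπ, x', ?_⟩
    have := hm.mono i
    rw [← cancel_mono (m.hom i), Category.assoc, hx, Category.assoc]
    exact (congrArg (· ≫ (kerLift a v hav.w).hom i) hx').symm.trans
      ((Category.assoc _ _ _).trans (congrArg (x' ≫ ·) h.symm))
  · exact congrArg (fun f => f.hom i) z₂
  · refine hm.exists_lift i x ?_
    have h : γ.hom i ≫ (kerι s).hom i = (kerι v).hom i ≫ r.hom i :=
      congrArg (fun f => f.hom i) hγ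
    have hx' : x ≫ γ.hom i = 0 := hx
    change x ≫ (kerι v).hom i ≫ r.hom i = 0
    rw [← h, reassoc_of% hx', zero_comp]
  · have := hqs.epi_kerLift i
    have h : (kerLift a v hav.w).hom i ≫ γ.hom i = (kerLift q s hqs.w).hom i :=
      congrArg (fun f => f.hom i) hγ'
    exact epi_of_epi_fac h

/-- For `B₂ ⟶ C₃` the common composite of two morphisms through `B₃` and `C₂`, the objects
`A₂ = ker (B₂ ⟶ C₂)` and `C₁ = ker (C₂ ⟶ C₃)` are the pieces of `S = ker (B₂ ⟶ C₃)`. -/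
lemma ses_ker_comp {A₂ B₂ C₁ C₂ C₃ : GrB E} {j : A₂ ⟶ B₂} {q : B₂ ⟶ C₂} {i : C₁ ⟶ C₂}
    {p : C₂ ⟶ C₃} {z₁ : j ≫ q = 0} {z₂ : i ≫ p = 0} (h₁ : ses E (.mk j q z₁))
    (h₂ : ses E (.mk i p z₂)) {r : B₂ ⟶ C₃} (hr : q ≫ p = r) {l : A₂ ⟶ ker r} {t : ker r ⟶ C₁}
    (hl : l ≫ kerι r = j) (ht : t ≫ i = kerι r ≫ q) :
    ∃ z : l ≫ t = 0, ses E (.mk l t z) := by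
  have k₁ := isKer_of_ses h₁
  have k₂ := isKer_of_ses h₂
  have kr := isKer_kerι r
  have z : l ≫ t = 0 := by
    refine k₂.cancel ?_
    change (l ≫ t) ≫ i = 0 ≫ i
    rw [Category.assoc, ht, ← Category.assoc, hl, z₁, zero_comp]
  have ht' (n : ℤ) : t.hom n ≫ i.hom n = (kerι r).hom n ≫ q.hom n :=
    congrArg (fun f => f.hom n) ht
  have hl' (n : ℤ) : l.hom n ≫ (kerι r).hom n = j.hom n := congrArg (fun f => f.hom n) hl
  refine ⟨z, ses_of_isKer ⟨fun n => ?_, fun n => ?_, fun n W x hx => ?_⟩ fun n => ?_⟩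
  · have : Mono (j.hom n) := k₁.mono n
    exact mono_of_mono_fac (hl' n)
  · exact congrArg (fun f => f.hom n) z
  · have hx' : x ≫ t.hom n = 0 := hx
    obtain ⟨y, hy⟩ := k₁.exists_lift n (x ≫ (kerι r).hom n) (by
      change _ ≫ q.hom n = 0
      rw [Category.assoc, ← ht', reassoc_of% hx', zero_comp])
    refine ⟨y, ?_⟩
    have := kr.mono n
    rw [← cancel_mono ((kerι r).hom n), ← hy, Category.assoc]
    exact congrArg (y ≫ ·) (hl' n)
  · have : Epi (q.hom n) := epi_of_ses h₁ n
    have : Mono (i.hom n) := k₂.mono n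
    have hr' : q.hom n ≫ p.hom n = r.hom n := congrArg (fun f => f.hom n) hr
    have z' : i.hom n ≫ p.hom n = 0 := k₂.zero n
    change Epi (t.hom n)
    rw [epi_iff_surjective_up_to_refinements]
    intro W y
    obtain ⟨W', π, hπ, x, hx⟩ := surjective_up_to_refinements_of_epi (q.hom n) (y ≫ i.hom n)
    obtain ⟨x', hx'⟩ := kr.exists_lift n x (by
      rw [← hr', ← reassoc_of% hx, z', comp_zero, comp_zero])
    refine ⟨W', π, hπ, x', ?_⟩
    rw [← cancel_mono (i.hom n), Category.assoc, hx, Category.assoc, ht', ← hx', Category.assoc]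

/-- The degreewise biproduct. -/
noncomputable def bicone (A B : GrB E) : BinaryBicone A B where
  pt := ⟨fun i => A.obj i ⊞ B.obj i, (A.property.union B.property).subset fun i hi => by
    by_contra h
    simp only [Set.mem_union, Set.mem_ofPred_eq, not_or, not_not] at h
    exact hi ((biprod_isZero_iff _ _).2 h)⟩
  fst := ObjectProperty.homMk fun i => biprod.fst
  snd := ObjectProperty.homMk fun i => biprod.snd
  inl := ObjectProperty.homMk fun i => biprod.inl
  inr := ObjectProperty.homMk fun i => biprod.inr
  inl_fst := hom_ext fun i => biprod.inl_fst
  inl_snd := hom_ext fun i => biprod.inl_snd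
  inr_fst := hom_ext fun i => biprod.inr_fst
  inr_snd := hom_ext fun i => biprod.inr_snd

lemma eq_add_of_total {W S A B : E} {fst : S ⟶ A} {inl : A ⟶ S} {snd : S ⟶ B} {inr : B ⟶ S}
    (h : fst ≫ inl + snd ≫ inr = 𝟙 S) (m : W ⟶ S) :
    m = (m ≫ fst) ≫ inl + (m ≫ snd) ≫ inr := by
  rw [Category.assoc, Category.assoc, ← Preadditive.comp_add, h, Category.comp_id]

lemma eq_add_of_total' {W S A B : E} {fst : S ⟶ A} {inl : A ⟶ S} {snd : S ⟶ B} {inr : B ⟶ S}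
    (h : fst ≫ inl + snd ≫ inr = 𝟙 S) (m : S ⟶ W) :
    m = fst ≫ inl ≫ m + snd ≫ inr ≫ m := by
  rw [← Category.assoc, ← Category.assoc, ← Preadditive.add_comp, h, Category.id_comp]

/-- A degreewise biproduct is a biproduct. -/
def isBilimitOfTotal {A B : GrB E} (s : BinaryBicone A B)
    (h : ∀ i, s.fst.hom i ≫ s.inl.hom i + s.snd.hom i ≫ s.inr.hom i = 𝟙 (s.pt.obj i)) :
    s.IsBilimit := by
  have hlf (i : ℤ) : s.inl.hom i ≫ s.fst.hom i = 𝟙 (A.obj i) :=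
    congrArg (fun f => f.hom i) s.inl_fst
  have hls (i : ℤ) : s.inl.hom i ≫ s.snd.hom i = 0 := congrArg (fun f => f.hom i) s.inl_snd
  have hrf (i : ℤ) : s.inr.hom i ≫ s.fst.hom i = 0 := congrArg (fun f => f.hom i) s.inr_fst
  have hrs (i : ℤ) : s.inr.hom i ≫ s.snd.hom i = 𝟙 (B.obj i) :=
    congrArg (fun f => f.hom i) s.inr_snd
  exact
  { isLimit := BinaryFan.IsLimit.mk _
      (fun f g => ObjectProperty.homMk fun i => f.hom i ≫ s.inl.hom i + g.hom i ≫ s.inr.hom i)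
      (fun f g => hom_ext fun i => by
        change (f.hom i ≫ s.inl.hom i + g.hom i ≫ s.inr.hom i) ≫ s.fst.hom i = f.hom i
        simp [hlf, hrf])
      (fun f g => hom_ext fun i => by
        change (f.hom i ≫ s.inl.hom i + g.hom i ≫ s.inr.hom i) ≫ s.snd.hom i = g.hom i
        simp [hls, hrs])
      (fun f g m hf hg => hom_ext fun i => by
        have hf' : m.hom i ≫ s.fst.hom i = f.hom i := congrArg (fun f => f.hom i) hf
        have hg' : m.hom i ≫ s.snd.hom i = g.hom i := congrArg (fun f => f.hom i) hg
        exact (eq_add_of_total (h i) (m.hom i)).trans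
          (congrArg₂ (fun a b => a ≫ s.inl.hom i + b ≫ s.inr.hom i) hf' hg'))
    isColimit := BinaryCofan.IsColimit.mk _
      (fun f g => ObjectProperty.homMk fun i => s.fst.hom i ≫ f.hom i + s.snd.hom i ≫ g.hom i)
      (fun f g => hom_ext fun i => by
        change s.inl.hom i ≫ (s.fst.hom i ≫ f.hom i + s.snd.hom i ≫ g.hom i) = f.hom i
        simp [reassoc_of% hlf, reassoc_of% hls])
      (fun f g => hom_ext fun i => by
        change s.inr.hom i ≫ (s.fst.hom i ≫ f.hom i + s.snd.hom i ≫ g.hom i) = g.hom i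
        simp [reassoc_of% hrf, reassoc_of% hrs])
      (fun f g m hf hg => hom_ext fun i => by
        have hf' : s.inl.hom i ≫ m.hom i = f.hom i := congrArg (fun f => f.hom i) hf
        have hg' : s.inr.hom i ≫ m.hom i = g.hom i := congrArg (fun f => f.hom i) hg
        exact (eq_add_of_total' (h i) (m.hom i)).trans
          (congrArg₂ (fun a b => s.fst.hom i ≫ a + s.snd.hom i ≫ b) hf' hg')) }

/-- The split short exact sequence of a degreewise biproduct. -/
lemma ses_inl_snd {A B : GrB E} (s : BinaryBicone A B)
    (h : ∀ i, s.fst.hom i ≫ s.inl.hom i + s.snd.hom i ≫ s.inr.hom i = 𝟙 (s.pt.obj i)) :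
    ses E (.mk s.inl s.snd s.inl_snd) := by
  refine ses_of_isKer ⟨fun i => ?_, fun i => ?_, fun i W x hx => ⟨x ≫ s.fst.hom i, ?_⟩⟩ fun i => ?_
  · have h : s.inl.hom i ≫ s.fst.hom i = 𝟙 (A.obj i) := congrArg (fun f => f.hom i) s.inl_fst
    exact mono_of_mono_fac h
  · exact congrArg (fun f => f.hom i) s.inl_snd
  · have hx' : x ≫ s.snd.hom i = 0 := hx
    change (x ≫ s.fst.hom i) ≫ s.inl.hom i = x
    have := congrArg (fun f => x ≫ f) (h i)
    simp only [Preadditive.comp_add, reassoc_of% hx', zero_comp, add_zero] at this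
    rw [Category.assoc, this]
    exact Category.comp_id _
  · have h : s.inr.hom i ≫ s.snd.hom i = 𝟙 (B.obj i) := congrArg (fun f => f.hom i) s.inr_snd
    exact epi_of_epi_fac h

lemma ses_inr_fst {A B : GrB E} (s : BinaryBicone A B)
    (h : ∀ i, s.fst.hom i ≫ s.inl.hom i + s.snd.hom i ≫ s.inr.hom i = 𝟙 (s.pt.obj i)) :
    ses E (.mk s.inr s.fst s.inr_fst) :=
  ses_inl_snd (BinaryBicone.mk s.pt s.snd s.fst s.inr s.inl s.inr_snd s.inr_fst s.inl_snd s.inl_fst)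
    fun i => by rw [add_comm]; exact h i

end GrB

end Graded

/-! ### Exact diagrams and determinant functors on graded objects -/

section Determinant

variable {E : Type u₂} [Category.{v₂} E] [Abelian E]
  {P : Type u₃} [Category.{v₃} P] [MonoidalCategory P] [SymmetricCategory P]
  {f : ExactDetData (GrB.ses E) P}

/-- Associativity for the kernels attached to a composite of two morphisms, see
`GrB.ses_kernels`. -/
lemma ExactDetData.IsDeterminant.associativity_kernels (hf : f.IsDeterminant)
    {X Y Y' Z Z' M : GrB E} {a : X ⟶ Y} {v : Y ⟶ Y'} {r : Y ⟶ Z}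
    {q : X ⟶ Z} {s : Z ⟶ Z'} (hq : a ≫ r = q) (hav : GrB.ExactAt a v) (hqs : GrB.ExactAt q s)
    {m : M ⟶ GrB.ker v} {α : GrB.ker a ⟶ GrB.ker q} {β : GrB.ker q ⟶ M}
    {γ : GrB.ker v ⟶ GrB.ker s} (hα : α ≫ GrB.kerι q = GrB.kerι a)
    (hβ : β ≫ m = GrB.kerι q ≫ GrB.kerLift a v hav.w) (hγ : γ ≫ GrB.kerι s = GrB.kerι v ≫ r)
    {z₁ : α ≫ β = 0} {z₂ : m ≫ γ = 0} (h₁ : GrB.ses E (.mk α β z₁))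
    (h₂ : GrB.ses E (.mk m γ z₂)) :
    (f.f₂ _ (GrB.kerSeq_ses q s hqs)).hom ≫ (f.f₂ _ h₁).hom ▷ _ =
      (f.f₂ _ (GrB.kerSeq_ses a v hav)).hom ≫ _ ◁ (f.f₂ _ h₂).hom ≫ (α_ _ _ _).inv := by
  refine hf.associativity α β (GrB.kerι a) (GrB.kerLift a v hav.w) (GrB.kerι q)
    (GrB.kerLift q s hqs.w) m γ z₁ _ _ z₂ h₁ (GrB.kerSeq_ses a v hav)
    (GrB.kerSeq_ses q s hqs) h₂ hα hβ ((GrB.isKer_kerι s).cancel ?_)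
  rw [Category.assoc, hγ, ← Category.assoc, GrB.kerLift_kerι, GrB.kerLift_kerι, hq]

open TensorWord in
/-- The formal part of the comparison made in `ExactDetData.IsDeterminant.three_by_three`. -/
lemma three_by_three_formal [PicardCategory P] {a₁ a₂ a₃ b₁ b₂ b₃ c₁ c₂ c₃ s q : P}
    {row₁ : a₂ ≅ a₁ ⊗ a₃} {row₂ : b₂ ≅ b₁ ⊗ b₃} {row₃ : c₂ ≅ c₁ ⊗ c₃}
    {col₁ : b₁ ≅ a₁ ⊗ c₁} {col₂ : b₂ ≅ a₂ ⊗ c₂} {col₃ : b₃ ≅ a₃ ⊗ c₃}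
    {sS : b₂ ≅ s ⊗ c₃} {sA : s ≅ a₂ ⊗ c₁} {sB : s ≅ b₁ ⊗ a₃} {sw : s ≅ a₁ ⊗ q}
    {sq : q ≅ a₃ ⊗ c₁}
    (h₁ : sS.hom ≫ sA.hom ▷ c₃ = col₂.hom ≫ a₂ ◁ row₃.hom ≫ (α_ _ _ _).inv)
    (h₂ : sS.hom ≫ sB.hom ▷ c₃ = row₂.hom ≫ b₁ ◁ col₃.hom ≫ (α_ _ _ _).inv)
    (h₃ : sA.hom ≫ row₁.hom ▷ c₁ = sw.hom ≫ a₁ ◁ sq.hom ≫ (α_ _ _ _).inv)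
    (h₄ : sB.hom ≫ col₁.hom ▷ a₃ =
      sw.hom ≫ a₁ ◁ (sq.hom ≫ (β_ _ _).hom) ≫ (α_ _ _ _).inv) :
    col₂.hom ≫ (row₁.hom ⊗ₘ row₃.hom) ≫ tensorμ _ _ _ _ =
      row₂.hom ≫ (col₁.hom ⊗ₘ col₃.hom) := by
  let X : Fin 4 → P := ![a₁, a₃, c₁, c₃]
  let k₁ : a₁ ≅ _ := varIso X 0
  let k₂ : a₃ ≅ _ := varIso X 1
  let k₃ : c₁ ≅ _ := varIso X 2
  let k₄ : c₃ ≅ _ := varIso X 3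
  have d₁ := IsStr.of_trans row₁ (mulIso k₁ k₂)
  have d₂ := IsStr.of_trans row₃ (mulIso k₃ k₄)
  have d₃ := IsStr.of_trans col₁ (mulIso k₁ k₃)
  have d₄ := IsStr.of_trans col₃ (mulIso k₂ k₄)
  have d₅ := IsStr.of_trans sq (mulIso k₂ k₃)
  have d₆ := IsStr.of_trans sw (mulIso k₁ (sq ≪≫ mulIso k₂ k₃))
  have d₇ := IsStr.of_comp (h₃ ▸ d₆.comp (d₅.whiskerLeft.comp IsStr.assoc_inv))
    (d₁.whiskerRight (i₁ := k₃))
  have d₈ := IsStr.of_comp (h₄ ▸ d₆.comp ((d₅.comp IsStr.braid).whiskerLeft.comp IsStr.assoc_inv))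
    (d₃.whiskerRight (i₁ := k₂))
  have d₉ := IsStr.of_trans sS (mulIso (sw ≪≫ mulIso k₁ (sq ≪≫ mulIso k₂ k₃)) k₄)
  have d₁₀ := IsStr.of_comp (h₁ ▸ d₉.comp d₇.whiskerRight) (d₂.whiskerLeft.comp IsStr.assoc_inv)
  have d₁₁ := IsStr.of_comp (h₂ ▸ d₉.comp d₈.whiskerRight) (d₄.whiskerLeft.comp IsStr.assoc_inv)
  exact (d₁₀.comp ((d₁.tensor d₂).comp IsStr.tensorμ)).eq (d₁₁.comp (d₃.tensor d₄)) (by decide)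

variable [PicardCategory P]

/-- A `3 × 3` diagram with short exact rows and columns identifies the determinant of its middle
object in two ways, through the middle column and through the middle row, with the product of the
determinants of the four corners. The identifications agree up to exchanging the middle factors.

Both are compared with the filtration `A₁ ⊆ A₂, B₁ ⊆ S ⊆ B₂`, where `S = ker (B₂ ⟶ C₃)` is the sum
of `A₂` and `B₁` and `S / A₁ = A₃ ⊕ C₁`; the exchange comes from the commutativity axiom for this
direct sum. -/
theorem ExactDetData.IsDeterminant.three_by_three (hf : f.IsDeterminant)
    {A₁ A₂ A₃ B₁ B₂ B₃ C₁ C₂ C₃ : GrB E}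
    {i₁ : A₁ ⟶ A₂} {p₁ : A₂ ⟶ A₃} {i₂ : B₁ ⟶ B₂} {p₂ : B₂ ⟶ B₃} {i₃ : C₁ ⟶ C₂} {p₃ : C₂ ⟶ C₃}
    {j₁ : A₁ ⟶ B₁} {q₁ : B₁ ⟶ C₁} {j₂ : A₂ ⟶ B₂} {q₂ : B₂ ⟶ C₂} {j₃ : A₃ ⟶ B₃} {q₃ : B₃ ⟶ C₃}
    {z₁ : i₁ ≫ p₁ = 0} {z₂ : i₂ ≫ p₂ = 0} {z₃ : i₃ ≫ p₃ = 0}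
    {w₁ : j₁ ≫ q₁ = 0} {w₂ : j₂ ≫ q₂ = 0} {w₃ : j₃ ≫ q₃ = 0}
    (r₁ : GrB.ses E (.mk i₁ p₁ z₁)) (r₂ : GrB.ses E (.mk i₂ p₂ z₂)) (r₃ : GrB.ses E (.mk i₃ p₃ z₃))
    (c₁ : GrB.ses E (.mk j₁ q₁ w₁)) (c₂ : GrB.ses E (.mk j₂ q₂ w₂)) (c₃ : GrB.ses E (.mk j₃ q₃ w₃))
    (e₁ : i₁ ≫ j₂ = j₁ ≫ i₂) (e₂ : p₁ ≫ j₃ = j₂ ≫ p₂) (e₃ : q₁ ≫ i₃ = i₂ ≫ q₂)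
    (e₄ : p₂ ≫ q₃ = q₂ ≫ p₃) :
    (f.f₂ _ c₂).hom ≫ ((f.f₂ _ r₁).hom ⊗ₘ (f.f₂ _ r₃).hom) ≫ tensorμ _ _ _ _ =
      (f.f₂ _ r₂).hom ≫ ((f.f₂ _ c₁).hom ⊗ₘ (f.f₂ _ c₃).hom) := by
  have kι := GrB.isKer_kerι (p₂ ≫ q₃)
  obtain ⟨lA, hlA⟩ := kι.exists_hom j₂ (by rw [e₄, reassoc_of% w₂, zero_comp])
  obtain ⟨lB, hlB⟩ := kι.exists_hom i₂ (by rw [reassoc_of% z₂, zero_comp])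
  obtain ⟨tA, htA⟩ := (GrB.isKer_of_ses c₃).exists_hom (GrB.kerι (p₂ ≫ q₃) ≫ p₂)
    ((Category.assoc _ _ _).trans (GrB.kerι_comp _))
  obtain ⟨tC, htC⟩ := (GrB.isKer_of_ses r₃).exists_hom (GrB.kerι (p₂ ≫ q₃) ≫ q₂)
    ((Category.assoc _ _ _).trans (e₄ ▸ GrB.kerι_comp _))
  dsimp only at htA htC
  obtain ⟨y₁, sA⟩ := GrB.ses_ker_comp c₂ r₃ e₄.symm hlA htC
  obtain ⟨y₂, sB⟩ := GrB.ses_ker_comp r₂ c₃ rfl hlB htA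
  have sS : GrB.ses E (.mk (GrB.kerι (p₂ ≫ q₃)) (p₂ ≫ q₃) (GrB.kerι_comp _)) :=
    GrB.ses_of_isKer kι fun i => by
      have : Epi (p₂.hom i) := GrB.epi_of_ses r₂ i
      have : Epi (q₃.hom i) := GrB.epi_of_ses c₃ i
      exact epi_comp (p₂.hom i) (q₃.hom i)
  have hlA' : lA ≫ tA = p₁ := (GrB.isKer_of_ses c₃).cancel (by
    change (lA ≫ tA) ≫ j₃ = p₁ ≫ j₃
    rw [Category.assoc, htA, reassoc_of% hlA, e₂])
  have hlB' : lB ≫ tC = q₁ := (GrB.isKer_of_ses r₃).cancel (by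
    change (lB ≫ tC) ≫ i₃ = q₁ ≫ i₃
    rw [Category.assoc, htC, reassoc_of% hlB, e₃])
  have hn : i₁ ≫ lA = j₁ ≫ lB := kι.cancel (by rw [Category.assoc, hlA, Category.assoc, hlB, e₁])
  -- The quotient `S / A₁` is the direct sum of `A₃` and `C₁`.
  let Q := GrB.bicone A₃ C₁
  have hQ (i : ℤ) : Q.fst.hom i ≫ Q.inl.hom i + Q.snd.hom i ≫ Q.inr.hom i = 𝟙 _ := biprod.total
  let w : GrB.ker (p₂ ≫ q₃) ⟶ Q.pt :=
    ObjectProperty.homMk fun i => biprod.lift (tA.hom i) (tC.hom i)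
  have hwf : w ≫ Q.fst = tA := GrB.hom_ext fun i => biprod.lift_fst _ _
  have hws : w ≫ Q.snd = tC := GrB.hom_ext fun i => biprod.lift_snd _ _
  have hlAw : p₁ ≫ Q.inl = lA ≫ w := GrB.hom_ext fun i => by
    have h₁ : lA.hom i ≫ tA.hom i = p₁.hom i := congrArg (fun f => f.hom i) hlA'
    have h₂ : lA.hom i ≫ tC.hom i = 0 := congrArg (fun f => f.hom i) y₁
    change p₁.hom i ≫ biprod.inl = lA.hom i ≫ biprod.lift (tA.hom i) (tC.hom i)
    ext <;> simp [h₁, h₂]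
  have hlBw : q₁ ≫ Q.inr = lB ≫ w := GrB.hom_ext fun i => by
    have h₁ : lB.hom i ≫ tC.hom i = q₁.hom i := congrArg (fun f => f.hom i) hlB'
    have h₂ : lB.hom i ≫ tA.hom i = 0 := congrArg (fun f => f.hom i) y₂
    change q₁.hom i ≫ biprod.inr = lB.hom i ≫ biprod.lift (tA.hom i) (tC.hom i)
    ext <;> simp [h₁, h₂]
  have zw : (i₁ ≫ lA) ≫ w = 0 := by rw [Category.assoc, ← hlAw, reassoc_of% z₁, zero_comp]
  have sw : GrB.ses E (.mk (i₁ ≫ lA) w zw) := by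
    refine GrB.ses_of_isKer ⟨fun i => ?_, fun i => congrArg (fun f => f.hom i) zw,
      fun i W x hx => ?_⟩ fun i => ?_
    · have : Mono (i₁.hom i) := (GrB.isKer_of_ses r₁).mono i
      have : Mono (lA.hom i) := (GrB.isKer_of_ses sA).mono i
      exact mono_comp (i₁.hom i) (lA.hom i)
    · have hx' : x ≫ biprod.lift (tA.hom i) (tC.hom i) = 0 := hx
      have hxA : x ≫ tA.hom i = 0 := by simpa using congrArg (· ≫ biprod.fst) hx'
      have hxC : x ≫ tC.hom i = 0 := by simpa using congrArg (· ≫ biprod.snd) hx'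
      obtain ⟨y, hy⟩ := (GrB.isKer_of_ses sA).exists_lift i x hxC
      have hy' : y ≫ lA.hom i = x := hy
      have h₁ : lA.hom i ≫ tA.hom i = p₁.hom i := congrArg (fun f => f.hom i) hlA'
      obtain ⟨y', hy''⟩ := (GrB.isKer_of_ses r₁).exists_lift i y (by
        change y ≫ p₁.hom i = 0
        rw [← h₁, reassoc_of% hy', hxA])
      have hy₂ : y' ≫ i₁.hom i = y := hy''
      refine ⟨y', ?_⟩
      change y' ≫ i₁.hom i ≫ lA.hom i = x
      rw [reassoc_of% hy₂, hy']
    · have : Epi (p₁.hom i) := GrB.epi_of_ses r₁ i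
      have : Epi (q₁.hom i) := GrB.epi_of_ses c₁ i
      have h₁ : p₁.hom i ≫ biprod.inl = lA.hom i ≫ biprod.lift (tA.hom i) (tC.hom i) :=
        congrArg (fun f => f.hom i) hlAw
      have h₂ : q₁.hom i ≫ biprod.inr = lB.hom i ≫ biprod.lift (tA.hom i) (tC.hom i) :=
        congrArg (fun f => f.hom i) hlBw
      change Epi (biprod.lift (tA.hom i) (tC.hom i))
      refine ⟨fun u v huv => biprod.hom_ext' _ _ ?_ ?_⟩
      · rw [← cancel_epi (p₁.hom i), reassoc_of% h₁, reassoc_of% h₁, huv]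
      · rw [← cancel_epi (q₁.hom i), reassoc_of% h₂, reassoc_of% h₂, huv]
  have a₁ := hf.associativity lA tC j₂ q₂ (GrB.kerι (p₂ ≫ q₃)) (p₂ ≫ q₃) i₃ p₃ y₁ w₂
    (GrB.kerι_comp _) z₃ sA c₂ sS r₃ hlA htC e₄.symm
  have a₂ := hf.associativity lB tA i₂ p₂ (GrB.kerι (p₂ ≫ q₃)) (p₂ ≫ q₃) j₃ q₃ y₂ z₂
    (GrB.kerι_comp _) w₃ sB r₂ sS c₃ hlB htA rfl
  have a₃ := hf.associativity i₁ p₁ (i₁ ≫ lA) w lA tC Q.inl Q.snd z₁ zw y₁ Q.inl_snd r₁ sw sA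
    (GrB.ses_inl_snd Q hQ) rfl hlAw hws
  have a₄ := hf.associativity j₁ q₁ (i₁ ≫ lA) w lB tA Q.inr Q.fst w₁ zw y₂ Q.inr_fst c₁ sw sB
    (GrB.ses_inr_fst Q hQ) hn.symm hlBw hwf
  have a₅ := hf.commutativity Q (GrB.isBilimitOfTotal Q hQ) (GrB.ses_inl_snd Q hQ)
    (GrB.ses_inr_fst Q hQ)
  rw [← a₅] at a₄
  exact three_by_three_formal a₁ a₂ a₃ a₄

end Determinant
end DetFun
namespace DetFun

/-! ### The octahedron of graded objects -/

section GradedOctahedron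

variable {E : Type u₂} [Category.{v₂} E] [Abelian E]

/-- For `v : X ⟶ Y` and `r : X ⟶ Z`, the kernel of the restriction of `r` to `ker v` is also the
kernel of the restriction of `v` to `ker r`. -/
lemma GrB.IsKer.symm {X Y Z N : GrB E} {v : X ⟶ Y} {r : X ⟶ Z} {m : N ⟶ GrB.ker v}
    (hm : GrB.IsKer m (GrB.kerι v ≫ r)) {m' : N ⟶ GrB.ker r}
    (h : m' ≫ GrB.kerι r = m ≫ GrB.kerι v) : GrB.IsKer m' (GrB.kerι r ≫ v) := by
  have kv := GrB.isKer_kerι v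
  have kr := GrB.isKer_kerι r
  have h' (i : ℤ) : m'.hom i ≫ (GrB.kerι r).hom i = m.hom i ≫ (GrB.kerι v).hom i :=
    congrArg (fun f => f.hom i) h
  refine ⟨fun i => ?_, fun i => ?_, fun i W x hx => ?_⟩
  · have := hm.mono i
    have := kv.mono i
    exact mono_of_mono_fac (h' i)
  · change m'.hom i ≫ (GrB.kerι r).hom i ≫ v.hom i = 0
    rw [reassoc_of% h', kv.zero, comp_zero]
  · have hx' : x ≫ (GrB.kerι r).hom i ≫ v.hom i = 0 := hx
    obtain ⟨y, hy⟩ := kv.exists_lift i (x ≫ (GrB.kerι r).hom i) (by rw [Category.assoc, hx'])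
    obtain ⟨y', hy'⟩ := hm.exists_lift i y (by
      change y ≫ (GrB.kerι v).hom i ≫ r.hom i = 0
      rw [reassoc_of% hy, kr.zero, comp_zero])
    refine ⟨y', ?_⟩
    have := kr.mono i
    rw [← cancel_mono ((GrB.kerι r).hom i), Category.assoc, h', reassoc_of% hy', hy]

variable {P : Type u₃} [Category.{v₃} P] [MonoidalCategory P] [SymmetricCategory P]
  [PicardCategory P]

/-- The isomorphism `[B] ≅ [A] ⊗ [C]` attached to a long exact sequence
`⋯ ⟶ A ⟶ B ⟶ C ⟶ TA ⟶ ⋯` of graded objects. -/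
noncomputable def exactSplice (g : GrDet E P) {A B C : GrB E} {a : A ⟶ B} {b : B ⟶ C}
    {c : C ⟶ (GrB.T E).obj A} (hab : GrB.ExactAt a b) (hbc : GrB.ExactAt b c)
    (hca : GrB.ExactAt c ((GrB.T E).map a)) : ob g.f₁ B ≅ ob g.f₁ A ⊗ ob g.f₁ C :=
  splice (g.μ (GrB.ker a)) (g.f₂ _ (GrB.kerSeq_ses b c hbc)) (g.f₂ _ (GrB.kerSeq_ses a b hab))
    (g.f₂ _ (GrB.kerSeq_ses c ((GrB.T E).map a) hca))

/-- The associativity axiom for an octahedron of long exact sequences. -/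
theorem exactSplice_octahedron (g : GrDet E P) {A B C A' B' C' : GrB E}
    {a : A ⟶ B} {b : B ⟶ C'} {x : C' ⟶ (GrB.T E).obj A}
    {u : A ⟶ C} {e : C ⟶ B'} {z : B' ⟶ (GrB.T E).obj A}
    {c : B ⟶ C} {p : C ⟶ A'} {y : A' ⟶ (GrB.T E).obj B}
    {d : C' ⟶ B'} {r : B' ⟶ A'} {w : A' ⟶ (GrB.T E).obj C'}
    (hab : GrB.ExactAt a b) (hbx : GrB.ExactAt b x) (hxa : GrB.ExactAt x ((GrB.T E).map a))
    (hue : GrB.ExactAt u e) (hez : GrB.ExactAt e z) (hzu : GrB.ExactAt z ((GrB.T E).map u))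
    (hcp : GrB.ExactAt c p) (hpy : GrB.ExactAt p y) (hyc : GrB.ExactAt y ((GrB.T E).map c))
    (hdr : GrB.ExactAt d r) (hrw : GrB.ExactAt r w) (hwd : GrB.ExactAt w ((GrB.T E).map d))
    (h₁ : a ≫ c = u) (h₂ : b ≫ d = c ≫ e) (h₃ : e ≫ r = p) (h₄ : d ≫ z = x)
    (h₅ : z ≫ (GrB.T E).map a = r ≫ y) (h₆ : y ≫ (GrB.T E).map b = w) :
    (exactSplice g hcp hpy hyc).hom ≫ (exactSplice g hab hbx hxa).hom ▷ ob g.f₁ A' =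
      (exactSplice g hue hez hzu).hom ≫ ob g.f₁ A ◁ (exactSplice g hdr hrw hwd).hom ≫
        (α_ _ _ _).inv := by
  have hf := g.isDeterminant
  -- `K₂` is the intersection of `ker b` and `ker c` in `B`.
  let mb := GrB.kerι (GrB.kerι b ≫ c)
  have kmb : GrB.IsKer mb (GrB.kerι b ≫ c) := GrB.isKer_kerι _
  obtain ⟨mc, hmc⟩ := (GrB.isKer_kerι c).exists_hom (mb ≫ GrB.kerι b)
    (by rw [Category.assoc]; exact GrB.kerι_comp _)
  have kmc : GrB.IsKer mc (GrB.kerι c ≫ b) := kmb.symm hmc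
  -- `K₅` is the intersection of `ker r` and `ker z` in `B'`.
  let nr := GrB.kerι (GrB.kerι r ≫ z)
  have knr : GrB.IsKer nr (GrB.kerι r ≫ z) := GrB.isKer_kerι _
  obtain ⟨nz, hnz⟩ := (GrB.isKer_kerι z).exists_hom (nr ≫ GrB.kerι r)
    (by rw [Category.assoc]; exact GrB.kerι_comp _)
  have knz : GrB.IsKer nz (GrB.kerι z ≫ r) := knr.symm hnz
  obtain ⟨αA, hαA⟩ := (GrB.isKer_kerι u).exists_hom (GrB.kerι a)
    (by rw [← h₁, reassoc_of% GrB.kerι_comp a, zero_comp])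
  obtain ⟨βA, hβA⟩ := kmb.exists_hom (GrB.kerι u ≫ GrB.kerLift a b hab.w)
    (by rw [Category.assoc, reassoc_of% GrB.kerLift_kerι a b, h₁, GrB.kerι_comp])
  obtain ⟨γA, hγA⟩ := (GrB.isKer_kerι e).exists_hom (GrB.kerι b ≫ c)
    (by rw [Category.assoc, ← h₂, reassoc_of% GrB.kerι_comp b, zero_comp])
  obtain ⟨αC', hαC'⟩ := (GrB.isKer_kerι x).exists_hom (GrB.kerι d)
    (by rw [← h₄, reassoc_of% GrB.kerι_comp d, zero_comp])
  obtain ⟨βC', hβC'⟩ := knr.exists_hom (GrB.kerι x ≫ GrB.kerLift d r hdr.w)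
    (by rw [Category.assoc, reassoc_of% GrB.kerLift_kerι d r, h₄, GrB.kerι_comp])
  obtain ⟨γC', hγC'⟩ := (GrB.isKer_kerι ((GrB.T E).map a)).exists_hom (GrB.kerι r ≫ z)
    (by rw [Category.assoc, h₅, reassoc_of% GrB.kerι_comp r, zero_comp])
  obtain ⟨αA', hαA'⟩ := (GrB.isKer_kerι w).exists_hom (GrB.kerι y)
    (by rw [← h₆, reassoc_of% GrB.kerι_comp y, zero_comp])
  obtain ⟨γc, hγc⟩ := (GrB.isKer_kerι d).exists_hom (GrB.kerι c ≫ b)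
    (by rw [Category.assoc, h₂, reassoc_of% GrB.kerι_comp c, zero_comp])
  -- Kernels are formed degreewise, so that `T (ker c)` is `ker (T c)`, and similarly below.
  have kTmc : GrB.IsKer (X := GrB.ker ((GrB.T E).map c)) ((GrB.T E).map mc)
      (GrB.kerι ((GrB.T E).map c) ≫ (GrB.T E).map b) := kmc.map_T
  have hγA' : (GrB.T E).map γc ≫ GrB.kerι ((GrB.T E).map d) =
      GrB.kerι ((GrB.T E).map c) ≫ (GrB.T E).map b := congrArg (GrB.T E).map hγc
  have hTα : (GrB.T E).map αA ≫ GrB.kerι ((GrB.T E).map u) = GrB.kerι ((GrB.T E).map a) :=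
    congrArg (GrB.T E).map hαA
  obtain ⟨βA', hβA'⟩ := kTmc.exists_hom (GrB.kerι w ≫ GrB.kerLift y ((GrB.T E).map c) hyc.w)
    (by rw [Category.assoc, reassoc_of% GrB.kerLift_kerι y ((GrB.T E).map c), h₆, GrB.kerι_comp])
  obtain ⟨αC, hαC⟩ := (GrB.isKer_kerι p).exists_hom (GrB.kerι e)
    (by rw [← h₃, reassoc_of% GrB.kerι_comp e, zero_comp])
  obtain ⟨βC, hβC⟩ := knz.exists_hom (GrB.kerι p ≫ GrB.kerLift e z hez.w)
    (by rw [Category.assoc, reassoc_of% GrB.kerLift_kerι e z, h₃, GrB.kerι_comp])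
  obtain ⟨γC, hγC⟩ := (GrB.isKer_kerι y).exists_hom (GrB.kerι z ≫ r)
    (by rw [Category.assoc, ← h₅, reassoc_of% GrB.kerι_comp z, zero_comp])
  -- The short exact sequences that decompose the kernels. That of `ker c` is first obtained for
  -- `ker (T c)`, from the triangle `C' ⟶ B' ⟶ A'`, and then translated back.
  obtain ⟨zA₁, zA₂, sku, skb⟩ := GrB.ses_kernels h₁ hab hue kmb hαA hβA hγA
  obtain ⟨zC₁', zC₂', skx, skg⟩ := GrB.ses_kernels h₄ hdr hxa knr hαC' hβC' hγC'
  obtain ⟨zA₁', zA₂', skw, sTkc⟩ := GrB.ses_kernels h₆ hyc hwd kTmc hαA' hβA' hγA'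
  obtain ⟨zC₁, zC₂, skp, skz⟩ := GrB.ses_kernels h₃ hez hpy knz hαC hβC hγC
  have zc : mc ≫ γc = 0 := (GrB.isKer_kerι d).cancel (by
    rw [Category.assoc, hγc, zero_comp]
    exact GrB.hom_ext kmc.zero)
  have skc : GrB.ses E (.mk mc γc zc) := GrB.ses_of_ses_map_T sTkc
  -- The `3 × 3` diagram with middle object `B`.
  have hB := hf.three_by_three skb (GrB.kerSeq_ses c p hcp) skx skc (GrB.kerSeq_ses b x hbx) skp
    hmc.symm
    ((GrB.isKer_kerι p).cancel (by
      rw [Category.assoc, hαC, hγA, Category.assoc, GrB.kerLift_kerι]))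
    ((GrB.isKer_kerι x).cancel (by
      rw [Category.assoc, hαC', hγc, Category.assoc, GrB.kerLift_kerι]))
    (knz.cancel ((GrB.isKer_kerι z).cancel (by
      rw [Category.assoc, Category.assoc, reassoc_of% hβC, GrB.kerLift_kerι,
        ← Category.assoc, GrB.kerLift_kerι, Category.assoc, Category.assoc, hnz,
        reassoc_of% hβC', GrB.kerLift_kerι, ← Category.assoc, GrB.kerLift_kerι, h₂])))
  have hTβ : (GrB.T E).map βA ≫ (GrB.T E).map mc ≫ GrB.kerι ((GrB.T E).map c) =
      GrB.kerι ((GrB.T E).map u) ≫ (GrB.T E).map a := by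
    have : βA ≫ mc ≫ GrB.kerι c = GrB.kerι u ≫ a := by
      rw [hmc, reassoc_of% hβA, GrB.kerLift_kerι]
    exact congrArg (GrB.T E).map this
  have hl (t : GrB.ker ((GrB.T E).map a) ⟶ GrB.ker ((GrB.T E).map u))
      (ht : t ≫ GrB.kerι ((GrB.T E).map u) = GrB.kerι ((GrB.T E).map a)) :
      γC' ≫ t = GrB.kerι r ≫ GrB.kerLift z ((GrB.T E).map u) hzu.w :=
    (GrB.isKer_kerι ((GrB.T E).map u)).cancel (by
      rw [Category.assoc, ht, hγC', Category.assoc, GrB.kerLift_kerι])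
  -- Stated for variable `βA'` and `m`, as `ker (T c)` and `T (ker c)` agree only definitionally.
  have hr {K : GrB E} {βA' : GrB.ker w ⟶ K} (t : GrB.ker ((GrB.T E).map u) ⟶ K)
      (m : K ⟶ GrB.ker ((GrB.T E).map c))
      (hm : GrB.IsKer m (GrB.kerι ((GrB.T E).map c) ≫ (GrB.T E).map b))
      (hβ : βA' ≫ m = GrB.kerι w ≫ GrB.kerLift y ((GrB.T E).map c) hyc.w)
      (ht : t ≫ m ≫ GrB.kerι ((GrB.T E).map c) =
        GrB.kerι ((GrB.T E).map u) ≫ (GrB.T E).map a) :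
      GrB.kerLift z ((GrB.T E).map u) hzu.w ≫ t = GrB.kerLift r w hrw.w ≫ βA' := by
    have hβ' : βA' ≫ m ≫ GrB.kerι ((GrB.T E).map c) = GrB.kerι w ≫ y := by
      rw [reassoc_of% hβ, GrB.kerLift_kerι]
    refine hm.cancel ((GrB.isKer_kerι ((GrB.T E).map c)).cancel ?_)
    rw [Category.assoc, Category.assoc, ht, ← Category.assoc, GrB.kerLift_kerι, h₅,
      Category.assoc, Category.assoc, hβ', ← Category.assoc, GrB.kerLift_kerι]
  -- The `3 × 3` diagram with middle object `B'`.
  have hB' := hf.three_by_three skg (GrB.kerSeq_ses z ((GrB.T E).map u) hzu) skw skz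
    (GrB.kerSeq_ses r w hrw) (GrB.ses_map_T E _ sku) hnz.symm
    (hl ((GrB.T E).map αA) hTα)
    ((GrB.isKer_kerι w).cancel (by
      rw [Category.assoc, hαA', hγC, Category.assoc, GrB.kerLift_kerι]))
    (hr ((GrB.T E).map βA) ((GrB.T E).map mc) kTmc hβA' hTβ)
  exact splice_octahedron
    (hf.associativity_kernels h₁ hab hue hαA hβA hγA sku skb)
    (hf.associativity_kernels h₄ hdr hxa hαC' hβC' hγC' skx skg)
    (hf.associativity_kernels h₆ hyc hwd hαA' hβA' hγA' skw sTkc)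
    (hf.associativity_kernels h₃ hez hpy hαC hβC hγC skp skz)
    hB hB' (g.μ_ses _ sku) (g.μ_ses _ skc)

end GradedOctahedron
end DetFun
namespace DetFun

/-! ### Zero objects and degenerate long exact sequences -/

section Degenerate

variable {P : Type u₃} [Category.{v₃} P] [MonoidalCategory P] [SymmetricCategory P]
  [PicardCategory P]

omit [SymmetricCategory P] [PicardCategory P] in
lemma eq_of_comp_tensorHom {X Y Z : P} {f h : X ⟶ Y ⊗ Z} {p : Y ⟶ Y} {q : Z ⟶ Z} (hp : p = 𝟙 _)
    (hq : q = 𝟙 _) (e : f ≫ (p ⊗ₘ q) = h) : f = h := by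
  rw [← e, hp, hq, id_tensorHom_id, Category.comp_id]

/-- If a unit structure `δ'` on `U` is a morphism of units from `(U, δ)` to its square, then `δ` and
`δ'` trivialize `U` in the same way. -/
lemma UnitStr.ε_eq_of_isUnitHom {U : P} {δ δ' : UnitStr U} (h : IsUnitHom δ (δ.prod δ) δ'.hom) :
    δ.ε = δ'.ε := by
  rw [isUnitHom_iff, UnitStr.prod_ε, MonoidalCategory.tensorHom_def',
    ← leftUnitor_inv_naturality_assoc, cancel_epi] at h
  refine UnitStr.eq_ε _ ?_
  rw [h, Iso.hom_inv_id_assoc]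

/-- Splicing along trivial objects `K` and `K'` does nothing. -/
lemma splice_trivial {K K' L M B : P} {δ : UnitStr (K ⊗ K')} {ζ : 𝟙_ P ⟶ K} {ζ' : 𝟙_ P ⟶ K'}
    (hδ : δ.ε = (λ_ _).inv ≫ (ζ ⊗ₘ ζ')) {s₁ : B ≅ L ⊗ M} {s₂ : L ≅ K ⊗ L} {s₃ : M ≅ M ⊗ K'}
    (h₂ : s₂.hom = (λ_ _).inv ≫ ζ ▷ L) (h₃ : s₃.hom = (ρ_ _).inv ≫ M ◁ ζ') :
    (splice δ s₁ s₂ s₃).hom = s₁.hom := by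
  have h : (s₂.inv ⊗ₘ s₃.inv) = (s₂ ⊗ᵢ s₃).inv := rfl
  have e₁ : (L ⊗ M) ◁ (ζ ⊗ₘ ζ') ≫ tensorμ L M K K' ≫ (β_ L K).hom ▷ (M ⊗ K') =
      tensorμ L M (𝟙_ P) (𝟙_ P) ≫ ((ρ_ L).hom ⊗ₘ (ρ_ M).hom) ≫ (s₂.hom ⊗ₘ s₃.hom) := by
    rw [reassoc_of% tensorμ_natural_right, ← tensorHom_id, tensorHom_comp_tensorHom,
      tensorHom_comp_tensorHom, h₂, h₃]
    simp
  rw [splice_hom, splicePure, h, ← Category.assoc, ← Category.assoc, ← Category.assoc,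
    ← Category.assoc, Iso.comp_inv_eq]
  simp only [Category.assoc]
  rw [whisker_exchange_assoc, hδ, whiskerLeft_comp, Category.assoc, e₁,
    ← reassoc_of% tensor_right_unitality L M, rightUnitor_naturality_assoc,
    Iso.inv_hom_id_assoc]
  rfl

/-- Splicing along trivial objects `K` and `K'` does nothing, up to the isomorphisms `A ≅ L` and
`C ≅ M` that result. -/
lemma splice_of_trivial {K K' L M A B C : P} {δ : UnitStr (K ⊗ K')} {ζ : 𝟙_ P ⟶ K} {ζ' : 𝟙_ P ⟶ K'}
    (hδ : δ.ε = (λ_ _).inv ≫ (ζ ⊗ₘ ζ')) {s₁ : B ≅ L ⊗ M} {s₂ : A ≅ K ⊗ L} {s₃ : C ≅ M ⊗ K'}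
    {a : A ⟶ L} {c : C ⟶ M} (h₂ : s₂.hom = a ≫ (λ_ _).inv ≫ ζ ▷ L)
    (h₃ : s₃.hom = c ≫ (ρ_ _).inv ≫ M ◁ ζ') :
    (splice δ s₁ s₂ s₃).hom ≫ (a ⊗ₘ c) = s₁.hom := by
  have key := splice_natural (δ := δ) (δ' := δ) (s₁ := s₁) (s₁' := s₁) (s₂ := s₂)
    (s₂' := asIso ((λ_ _).inv ≫ ζ ▷ L)) (s₃ := s₃) (s₃' := asIso ((ρ_ _).inv ≫ M ◁ ζ'))
    (k := 𝟙 _) (k' := 𝟙 _) (l := 𝟙 _) (m := 𝟙 _) (a := a) (b := 𝟙 _) (c := c)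
    (by simp [IsUnitHom]) (by simp) (by simp [h₂]) (by simp [h₃])
  rw [key, Category.id_comp]
  exact splice_trivial hδ rfl rfl

end Degenerate

section GradedDegenerate

variable {E : Type u₂} [Category.{v₂} E] [Abelian E]

omit [Abelian E] in
lemma GrB.eq_of_isZero_left {Z X : GrB E} (hZ : ∀ i, IsZero (Z.obj i)) (f g : Z ⟶ X) : f = g :=
  GrB.hom_ext fun i => (hZ i).eq_of_src _ _

omit [Abelian E] in
lemma GrB.eq_of_isZero_right {Z X : GrB E} (hZ : ∀ i, IsZero (Z.obj i)) (f g : X ⟶ Z) : f = g :=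
  GrB.hom_ext fun i => (hZ i).eq_of_tgt _ _

lemma GrB.ses_zero_left {Z : GrB E} (hZ : ∀ i, IsZero (Z.obj i)) (X : GrB E) :
    GrB.ses E (.mk (0 : Z ⟶ X) (𝟙 X) zero_comp) := by
  refine GrB.ses_of_isKer ⟨fun i => ⟨fun _ _ _ => (hZ i).eq_of_tgt _ _⟩, fun _ => zero_comp,
    fun i W x hx => ⟨0, ?_⟩⟩ fun i => inferInstanceAs (Epi (𝟙 (X.obj i)))
  have hx' : x ≫ 𝟙 (X.obj i) = 0 := hx
  rw [zero_comp, ← hx', Category.comp_id]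

lemma GrB.ses_zero_right {Z : GrB E} (hZ : ∀ i, IsZero (Z.obj i)) (X : GrB E) :
    GrB.ses E (.mk (𝟙 X) (0 : X ⟶ Z) comp_zero) :=
  GrB.ses_of_isKer ⟨fun i => inferInstanceAs (Mono (𝟙 (X.obj i))), fun _ => comp_zero,
    fun _ _ x _ => ⟨x, Category.comp_id x⟩⟩ fun i => ⟨fun _ _ _ => (hZ i).eq_of_src _ _⟩

variable {P : Type u₃} [Category.{v₃} P] [MonoidalCategory P] [SymmetricCategory P]
  [PicardCategory P] {f : ExactDetData (GrB.ses E) P}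

/-- The determinant of a zero object `Z` is trivialized by the short exact sequence
`Z ⟶ Z ⟶ Z`. -/
noncomputable def zeroUnit (f : ExactDetData (GrB.ses E) P) {Z : GrB E}
    (hZ : ∀ i, IsZero (Z.obj i)) : UnitStr (ob f.f₁ Z) :=
  f.f₂ _ (GrB.ses_zero_left hZ Z)

namespace ExactDetData.IsDeterminant

lemma f₂_zero_right (hf : f.IsDeterminant) {Z : GrB E} (hZ : ∀ i, IsZero (Z.obj i)) (X : GrB E) :
    (f.f₂ _ (GrB.ses_zero_right hZ X)).hom = (ρ_ _).inv ≫ _ ◁ (zeroUnit f hZ).ε := by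
  have h := hf.associativity (𝟙 X) (0 : X ⟶ Z) (𝟙 X) (0 : X ⟶ Z) (𝟙 X) (0 : X ⟶ Z) (0 : Z ⟶ Z)
    (𝟙 Z) comp_zero comp_zero comp_zero zero_comp (GrB.ses_zero_right hZ X)
    (GrB.ses_zero_right hZ X) (GrB.ses_zero_right hZ X) (GrB.ses_zero_left hZ Z)
    (Category.comp_id _) (GrB.eq_of_isZero_right hZ _ _) (GrB.eq_of_isZero_right hZ _ _)
  rw [cancel_epi] at h
  rw [← UnitStr.ρ_eq]
  exact whiskerRight_cancel _ (h.trans (UnitStr.ρ_whiskerRight _ _).symm)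

lemma f₂_zero_left (hf : f.IsDeterminant) {Z : GrB E} (hZ : ∀ i, IsZero (Z.obj i)) (X : GrB E) :
    (f.f₂ _ (GrB.ses_zero_left hZ X)).hom = (λ_ _).inv ≫ (zeroUnit f hZ).ε ▷ _ := by
  have key (X : GrB E) : (zeroUnit f hZ).hom ▷ ob f.f₁ X =
      ob f.f₁ Z ◁ (f.f₂ _ (GrB.ses_zero_left hZ X)).hom ≫ (α_ _ _ _).inv := by
    have h := hf.associativity (0 : Z ⟶ Z) (𝟙 Z) (0 : Z ⟶ X) (𝟙 X) (0 : Z ⟶ X) (𝟙 X)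
      (0 : Z ⟶ X) (𝟙 X) zero_comp zero_comp zero_comp zero_comp (GrB.ses_zero_left hZ Z)
      (GrB.ses_zero_left hZ X) (GrB.ses_zero_left hZ X) (GrB.ses_zero_left hZ X)
      (GrB.eq_of_isZero_left hZ _ _) (GrB.eq_of_isZero_left hZ _ _) (Category.comp_id _)
    rwa [cancel_epi] at h
  have hδ : (zeroUnit f hZ).hom = (ρ_ _).inv ≫ _ ◁ (zeroUnit f hZ).ε := by
    rw [← UnitStr.ρ_eq]
    exact whiskerRight_cancel _ ((key Z).trans (UnitStr.ρ_whiskerRight _ _).symm)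
  apply whiskerLeft_cancel (ob f.f₁ Z)
  rw [← cancel_mono (α_ _ _ _).inv]
  refine (key X).symm.trans ?_
  rw [hδ]
  simp

end ExactDetData.IsDeterminant

/-- For a zero object `Z` the unit structure of `[Z] ⊗ [TZ]` is the product of those of `[Z]` and
`[TZ]`. -/
lemma μ_ε_of_isZero (g : GrDet E P) {Z : GrB E} (hZ : ∀ i, IsZero (Z.obj i)) :
    (g.μ Z).ε = (λ_ _).inv ≫ ((zeroUnit g.toExactDetData hZ).ε ⊗ₘ
      (zeroUnit g.toExactDetData (Z := (GrB.T E).obj Z) fun i => hZ (i + 1)).ε) := by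
  rw [← UnitStr.prod_ε]
  exact UnitStr.ε_eq_of_isUnitHom (g.μ_ses _ (GrB.ses_zero_left hZ Z))

/-- If `0 ⟶ A ⟶ B ⟶ C ⟶ 0` is short exact, then the isomorphism `[B] ≅ [A] ⊗ [C]` belonging to
the long exact sequence is the one belonging to the short exact sequence. -/
theorem exactSplice_of_ses (g : GrDet E P) {A B C : GrB E} {a : A ⟶ B} {b : B ⟶ C}
    {c : C ⟶ (GrB.T E).obj A} (hab : GrB.ExactAt a b) (hbc : GrB.ExactAt b c)
    (hca : GrB.ExactAt c ((GrB.T E).map a)) {z : a ≫ b = 0} (h : GrB.ses E (.mk a b z)) :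
    (exactSplice g hab hbc hca).hom = (g.f₂ _ h).hom := by
  have hf := g.isDeterminant
  have ka := GrB.isKer_of_ses h
  have kb := GrB.isKer_kerι b
  have kc := GrB.isKer_kerι c
  have hZ : ∀ i, IsZero ((GrB.ker a).obj i) := fun i => by
    have : Mono (a.hom i) := ka.mono i
    exact isZero_kernel_of_mono (a.hom i)
  have hc : c = 0 := GrB.cancel_epi_of_ses h (by
    change b ≫ c = b ≫ 0
    rw [comp_zero, hbc.comp_eq_zero])
  obtain ⟨l, hl⟩ := ka.exists_hom (GrB.kerι b) (GrB.kerι_comp b)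
  obtain ⟨m, hm⟩ := kc.exists_hom (𝟙 C) (by rw [hc, comp_zero])
  dsimp only at hl
  let eA : A ≅ GrB.ker b :=
    { hom := GrB.kerLift a b hab.w
      inv := l
      hom_inv_id := ka.cancel (by
        change (GrB.kerLift a b hab.w ≫ l) ≫ a = 𝟙 A ≫ a
        rw [Category.assoc, hl, GrB.kerLift_kerι, Category.id_comp])
      inv_hom_id := kb.cancel (by
        rw [Category.assoc, GrB.kerLift_kerι, hl, Category.id_comp]) }
  let eC : C ≅ GrB.ker c :=
    { hom := m
      inv := GrB.kerι c
      hom_inv_id := hm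
      inv_hom_id := kc.cancel (by rw [Category.assoc, hm, Category.comp_id, Category.id_comp]) }
  have n₁ := hf.naturality (.mk a b z) (GrB.kerSeq b c hbc.w) h (GrB.kerSeq_ses b c hbc) eA
    (Iso.refl B) eC
    (by exact (Category.comp_id _).trans (GrB.kerLift_kerι a b hab.w).symm)
    (kc.cancel (by
      change (b ≫ m) ≫ GrB.kerι c = (𝟙 B ≫ GrB.kerLift b c hbc.w) ≫ GrB.kerι c
      rw [Category.assoc, hm, Category.comp_id, Category.id_comp, GrB.kerLift_kerι]))
  have n₂ := hf.naturality (GrB.kerSeq a b hab.w) (.mk (0 : GrB.ker a ⟶ GrB.ker b) (𝟙 _) zero_comp)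
    (GrB.kerSeq_ses a b hab) (GrB.ses_zero_left hZ _) (Iso.refl (GrB.ker a)) eA
    (Iso.refl (GrB.ker b)) (GrB.eq_of_isZero_left hZ _ _)
    (by exact (Category.comp_id _).trans (Category.comp_id _).symm)
  have n₃ := hf.naturality (GrB.kerSeq c ((GrB.T E).map a) hca.w)
    (.mk (𝟙 (GrB.ker c)) (0 : GrB.ker c ⟶ (GrB.T E).obj (GrB.ker a)) comp_zero)
    (GrB.kerSeq_ses c _ hca) (GrB.ses_zero_right (fun i => hZ (i + 1)) _) (Iso.refl (GrB.ker c)) eC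
    (Iso.refl ((GrB.T E).obj (GrB.ker a)))
    (by exact kc.cancel (by
      change (GrB.kerι c ≫ m) ≫ GrB.kerι c = (𝟙 _ ≫ 𝟙 _) ≫ GrB.kerι c
      rw [Category.assoc, hm, Category.comp_id, Category.id_comp, Category.id_comp]))
    (GrB.eq_of_isZero_right (fun i => hZ (i + 1)) _ _)
  have hrefl (X : GrB E) : mp g.f₁ (Iso.refl X) = 𝟙 _ := g.f₁.map_id ⟨X⟩
  have hs₁ : (g.f₂ _ h).hom ≫ (mp g.f₁ eA ⊗ₘ mp g.f₁ eC) =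
      (g.f₂ _ (GrB.kerSeq_ses b c hbc)).hom :=
    n₁.trans ((congrArg (· ≫ (g.f₂ _ (GrB.kerSeq_ses b c hbc)).hom) (hrefl B)).trans
      (Category.id_comp _))
  have hs₂ : (g.f₂ _ (GrB.kerSeq_ses a b hab)).hom =
      mp g.f₁ eA ≫ (λ_ _).inv ≫ (zeroUnit g.toExactDetData hZ).ε ▷ ob g.f₁ (GrB.ker b) :=
    (eq_of_comp_tensorHom (hrefl _) (hrefl _) n₂).trans
      (congrArg (mp g.f₁ eA ≫ ·) (hf.f₂_zero_left hZ _))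
  have hs₃ : (g.f₂ _ (GrB.kerSeq_ses c ((GrB.T E).map a) hca)).hom =
      mp g.f₁ eC ≫ (ρ_ _).inv ≫ ob g.f₁ (GrB.ker c) ◁ (zeroUnit g.toExactDetData
        (Z := (GrB.T E).obj (GrB.ker a)) fun i => hZ (i + 1)).ε :=
    (eq_of_comp_tensorHom (hrefl _) (hrefl _) n₃).trans
      (congrArg (mp g.f₁ eC ≫ ·) (hf.f₂_zero_right _ _))
  have key := (splice_of_trivial (μ_ε_of_isZero g hZ) (s₁ := g.f₂ _ (GrB.kerSeq_ses b c hbc))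
    hs₂ hs₃).trans hs₁.symm
  have : IsIso (mp g.f₁ eA ⊗ₘ mp g.f₁ eC) := isIso_of_picard _
  exact (cancel_mono (mp g.f₁ eA ⊗ₘ mp g.f₁ eC)).1 key

end GradedDegenerate
end DetFun
namespace DetFun

/-! ### Naturality of the determinants of long exact sequences -/

section Naturality

variable {E : Type u₂} [Category.{v₂} E] [Abelian E]

lemma GrB.exists_ker_iso {X Y X' Y' : GrB E} {φ : X ⟶ Y} {φ' : X' ⟶ Y'} (e : X ≅ X') (h : Y ≅ Y')
    (w : φ ≫ h.hom = e.hom ≫ φ') :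
    ∃ k : GrB.ker φ ≅ GrB.ker φ', k.hom ≫ GrB.kerι φ' = GrB.kerι φ ≫ e.hom := by
  have w' : φ' ≫ h.inv = e.inv ≫ φ := by rw [Iso.comp_inv_eq, Category.assoc, w, e.inv_hom_id_assoc]
  obtain ⟨k, hk⟩ := (GrB.isKer_kerι φ').exists_hom (GrB.kerι φ ≫ e.hom) (by
    rw [Category.assoc, ← w, reassoc_of% GrB.kerι_comp φ, zero_comp])
  obtain ⟨l, hl⟩ := (GrB.isKer_kerι φ).exists_hom (GrB.kerι φ' ≫ e.inv) (by
    rw [Category.assoc, ← w', reassoc_of% GrB.kerι_comp φ', zero_comp])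
  refine ⟨⟨k, l, (GrB.isKer_kerι φ).cancel ?_, (GrB.isKer_kerι φ').cancel ?_⟩, hk⟩
  · rw [Category.assoc, hl, reassoc_of% hk, e.hom_inv_id, Category.comp_id, Category.id_comp]
  · rw [Category.assoc, hk, reassoc_of% hl, e.inv_hom_id, Category.comp_id, Category.id_comp]

variable {P : Type u₃} [Category.{v₃} P] [MonoidalCategory P] [SymmetricCategory P]

lemma ExactDetData.IsDeterminant.naturality_kerSeq {f : ExactDetData (GrB.ses E) P}
    (hf : f.IsDeterminant) {A B C A' B' C' : GrB E} {a : A ⟶ B} {b : B ⟶ C} {a' : A' ⟶ B'}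
    {b' : B' ⟶ C'} (h : GrB.ExactAt a b) (h' : GrB.ExactAt a' b') (eA : A ≅ A') {eB : B ≅ B'}
    {ka : GrB.ker a ≅ GrB.ker a'} {kb : GrB.ker b ≅ GrB.ker b'} (w : a ≫ eB.hom = eA.hom ≫ a')
    (hka : ka.hom ≫ GrB.kerι a' = GrB.kerι a ≫ eA.hom)
    (hkb : kb.hom ≫ GrB.kerι b' = GrB.kerι b ≫ eB.hom) :
    (f.f₂ _ (GrB.kerSeq_ses a b h)).hom ≫ (mp f.f₁ ka ⊗ₘ mp f.f₁ kb) =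
      mp f.f₁ eA ≫ (f.f₂ _ (GrB.kerSeq_ses a' b' h')).hom :=
  hf.naturality (GrB.kerSeq a b h.w) (GrB.kerSeq a' b' h'.w) _ _ ka eA kb hka.symm
    ((GrB.isKer_kerι b').cancel (by
      change (GrB.kerLift a b h.w ≫ kb.hom) ≫ GrB.kerι b' =
        (eA.hom ≫ GrB.kerLift a' b' h'.w) ≫ GrB.kerι b'
      rw [Category.assoc, hkb, ← Category.assoc, GrB.kerLift_kerι, w, Category.assoc,
        GrB.kerLift_kerι]))

variable [PicardCategory P]

theorem exactSplice_naturality (g : GrDet E P) {A B C A' B' C' : GrB E} {a : A ⟶ B} {b : B ⟶ C}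
    {c : C ⟶ (GrB.T E).obj A} {a' : A' ⟶ B'} {b' : B' ⟶ C'} {c' : C' ⟶ (GrB.T E).obj A'}
    (hab : GrB.ExactAt a b) (hbc : GrB.ExactAt b c) (hca : GrB.ExactAt c ((GrB.T E).map a))
    (hab' : GrB.ExactAt a' b') (hbc' : GrB.ExactAt b' c')
    (hca' : GrB.ExactAt c' ((GrB.T E).map a')) (eA : A ≅ A') (eB : B ≅ B') (eC : C ≅ C')
    (h₁ : a ≫ eB.hom = eA.hom ≫ a') (h₂ : b ≫ eC.hom = eB.hom ≫ b')
    (h₃ : c ≫ (GrB.T E).map eA.hom = eC.hom ≫ c') :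
    (exactSplice g hab hbc hca).hom ≫ (mp g.f₁ eA ⊗ₘ mp g.f₁ eC) =
      mp g.f₁ eB ≫ (exactSplice g hab' hbc' hca').hom := by
  have hf := g.isDeterminant
  obtain ⟨ka, hka⟩ := GrB.exists_ker_iso eA eB h₁
  obtain ⟨kb, hkb⟩ := GrB.exists_ker_iso eB eC h₂
  obtain ⟨kc, hkc⟩ := GrB.exists_ker_iso eC ((GrB.T E).mapIso eA) h₃
  exact splice_natural (g.μ_iso ka) (hf.naturality_kerSeq hbc hbc' eB h₂ hkb hkc)
    (hf.naturality_kerSeq hab hab' eA h₁ hka hkb)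
    (hf.naturality_kerSeq (eB := (GrB.T E).mapIso eA) (kb := (GrB.T E).mapIso ka) hca hca' eC h₃ hkc
      (congrArg (GrB.T E).map hka))

/-- Morphisms of determinant functors on graded objects are compatible with the determinants of
long exact sequences. -/
theorem exactSplice_hom {g g' : GrDet E P} (l : TransDet.Hom g g') {A B C : GrB E} {a : A ⟶ B}
    {b : B ⟶ C} {c : C ⟶ (GrB.T E).obj A} (hab : GrB.ExactAt a b) (hbc : GrB.ExactAt b c)
    (hca : GrB.ExactAt c ((GrB.T E).map a)) :
    (exactSplice g hab hbc hca).hom ≫ (l.iso.hom.app ⟨A⟩ ⊗ₘ l.iso.hom.app ⟨C⟩) =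
      l.iso.hom.app ⟨B⟩ ≫ (exactSplice g' hab hbc hca).hom :=
  splice_natural (l.unit (GrB.ker a)) (l.comm _ (GrB.kerSeq_ses b c hbc))
    (l.comm _ (GrB.kerSeq_ses a b hab)) (l.comm _ (GrB.kerSeq_ses c ((GrB.T E).map a) hca))

end Naturality

/-! ### The determinant functor induced by a bounded cohomological functor -/

section Cohomological

section Translation

variable {𝒯 : Type u₁} [Category.{v₁} 𝒯] [HasShift 𝒯 ℤ] {E : Type u₂} [Category.{v₂} E]
  (H : 𝒯 ⥤ E) (hH : IsBounded H)

lemma tildeShift_naturality {A B : 𝒯} (f : A ⟶ B) :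
    (tilde H hH).map ((shiftFunctor 𝒯 (1 : ℤ)).map f) ≫ (tildeShift H hH B).hom =
      (tildeShift H hH A).hom ≫ (GrB.T E).map ((tilde H hH).map f) :=
  GrB.hom_ext fun i => by
    change H.map _ ≫ H.map _ = H.map _ ≫ H.map _
    rw [← H.map_comp, ← H.map_comp]
    exact congrArg H.map ((shiftFunctorAdd' 𝒯 1 i (i + 1) (add_comm 1 i)).inv.naturality f)

lemma comp_tildeδ {C C' A : 𝒯} (f : C ⟶ C') (c : C' ⟶ (shiftFunctor 𝒯 (1 : ℤ)).obj A) :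
    (tilde H hH).map f ≫ tildeδ H hH c = tildeδ H hH (f ≫ c) := by
  rw [tildeδ, tildeδ, Functor.map_comp, Category.assoc]

lemma tildeδ_comp {C A B : 𝒯} (c : C ⟶ (shiftFunctor 𝒯 (1 : ℤ)).obj A) (f : A ⟶ B) :
    tildeδ H hH c ≫ (GrB.T E).map ((tilde H hH).map f) =
      tildeδ H hH (c ≫ (shiftFunctor 𝒯 (1 : ℤ)).map f) := by
  rw [tildeδ, tildeδ, Functor.map_comp, Category.assoc, Category.assoc, tildeShift_naturality]

end Translation

variable {𝒯 : Type u₁} [Category.{v₁} 𝒯] [Preadditive 𝒯] [HasZeroObject 𝒯] [HasShift 𝒯 ℤ]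
  [∀ n : ℤ, (shiftFunctor 𝒯 n).Additive] [Pretriangulated 𝒯]
  {E : Type u₂} [Category.{v₂} E] [Abelian E] (H : 𝒯 ⥤ E) (hH : IsBounded H)

/-- The image under `H̃` of a binary bicone. -/
def tildeBicone [H.PreservesZeroMorphisms] {A B : 𝒯} (s : BinaryBicone A B) :
    BinaryBicone ((tilde H hH).obj A) ((tilde H hH).obj B) :=
  have hz {X Y : 𝒯} : (tilde H hH).map (0 : X ⟶ Y) = 0 := GrB.hom_ext fun i => by
    change H.map ((shiftFunctor 𝒯 i).map 0) = 0
    rw [Functor.map_zero, Functor.map_zero]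
  { pt := (tilde H hH).obj s.pt
    fst := (tilde H hH).map s.fst
    snd := (tilde H hH).map s.snd
    inl := (tilde H hH).map s.inl
    inr := (tilde H hH).map s.inr
    inl_fst := by rw [← Functor.map_comp, s.inl_fst, CategoryTheory.Functor.map_id]
    inl_snd := by rw [← Functor.map_comp, s.inl_snd, hz]
    inr_fst := by rw [← Functor.map_comp, s.inr_fst, hz]
    inr_snd := by rw [← Functor.map_comp, s.inr_snd, CategoryTheory.Functor.map_id] }

variable [H.IsHomological]

lemma tildeBicone_total {A B : 𝒯} (s : BinaryBicone A B) (hs : s.IsBilimit) (i : ℤ) :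
    (tildeBicone H hH s).fst.hom i ≫ (tildeBicone H hH s).inl.hom i +
      (tildeBicone H hH s).snd.hom i ≫ (tildeBicone H hH s).inr.hom i =
        𝟙 ((tildeBicone H hH s).pt.obj i) := by
  have h := congrArg (fun f => H.map ((shiftFunctor 𝒯 i).map f)) (IsBilimit.binary_total hs)
  simp only [Functor.map_add, Functor.map_comp, CategoryTheory.Functor.map_id] at h
  exact h

variable {P : Type u₃} [Category.{v₃} P] [MonoidalCategory P] [SymmetricCategory P]
  [PicardCategory P]

theorem starData_isDeterminant (g : GrDet E P) : (starData H hH g).IsDeterminant where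
  naturality Δ Δ' h h' a b c h₁ h₂ h₃ :=
    exactSplice_naturality g (exactAt₂ H hH Δ h) (exactAt₃ H hH Δ h) (exactAt₁ H hH Δ h)
      (exactAt₂ H hH Δ' h') (exactAt₃ H hH Δ' h') (exactAt₁ H hH Δ' h')
      ((tilde H hH).mapIso a) ((tilde H hH).mapIso b) ((tilde H hH).mapIso c)
      (by simp only [Functor.mapIso_hom, ← Functor.map_comp, h₁])
      (by simp only [Functor.mapIso_hom, ← Functor.map_comp, h₂])
      (by simp only [Functor.mapIso_hom, comp_tildeδ, tildeδ_comp, h₃])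
  associativity {A B C A' B' C' a c u} w {b x} h1 {p y} v1 {e z} h2 o := by
    exact exactSplice_octahedron g (a := (tilde H hH).map a) (b := (tilde H hH).map b)
      (x := tildeδ H hH x) (u := (tilde H hH).map u) (e := (tilde H hH).map e)
      (z := tildeδ H hH z) (c := (tilde H hH).map c) (p := (tilde H hH).map p)
      (y := tildeδ H hH y) (d := (tilde H hH).map o.m₁) (r := (tilde H hH).map o.m₃)
      (w := tildeδ H hH (y ≫ (shiftFunctor 𝒯 (1 : ℤ)).map b))
      (exactAt₂ H hH _ h1) (exactAt₃ H hH _ h1) (exactAt₁ H hH _ h1)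
      (exactAt₂ H hH _ h2) (exactAt₃ H hH _ h2) (exactAt₁ H hH _ h2)
      (exactAt₂ H hH _ v1) (exactAt₃ H hH _ v1) (exactAt₁ H hH _ v1)
      (exactAt₂ H hH _ o.mem) (exactAt₃ H hH _ o.mem) (exactAt₁ H hH _ o.mem)
      (by rw [← Functor.map_comp, w])
      (by rw [← Functor.map_comp, ← Functor.map_comp, o.comm₁])
      (by rw [← Functor.map_comp, o.comm₃])
      (by rw [comp_tildeδ, o.comm₂])
      (by rw [tildeδ_comp, comp_tildeδ, o.comm₄])
      (tildeδ_comp H hH y b)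
  commutativity {A B} s hs h1 h2 := by
    have ht := tildeBicone_total H hH s hs
    have s₁ := GrB.ses_inl_snd _ ht
    have s₂ := GrB.ses_inr_fst _ ht
    have e₁ := exactSplice_of_ses g (exactAt₂ H hH _ h1) (exactAt₃ H hH _ h1)
      (exactAt₁ H hH _ h1) s₁
    have e₂ := exactSplice_of_ses g (exactAt₂ H hH _ h2) (exactAt₃ H hH _ h2)
      (exactAt₁ H hH _ h2) s₂
    exact (congrArg (· ≫ (β_ _ _).hom) e₁).trans
      ((g.isDeterminant.commutativity _ (GrB.isBilimitOfTotal _ ht) s₁ s₂).trans e₂.symm)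

theorem starIso_isMorphism {g g' : GrDet E P} (l : g ⟶ g') :
    TriDetData.IsMorphism (starIso H hH l) := fun Δ h =>
  exactSplice_hom l (exactAt₂ H hH Δ h) (exactAt₃ H hH Δ h) (exactAt₁ H hH Δ h)

end Cohomological

end DetFun

theorem mainTheorem5
    {𝒯 : Type u₁} [Category.{v₁} 𝒯] [Preadditive 𝒯] [HasZeroObject 𝒯] [HasShift 𝒯 ℤ]
    [∀ n : ℤ, (shiftFunctor 𝒯 n).Additive] [Pretriangulated 𝒯] [IsTriangulated 𝒯]
    {E : Type u₂} [Category.{v₂} E] [Abelian E]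
    {P : Type u₃} [Category.{v₃} P] [MonoidalCategory P] [SymmetricCategory P]
    [DetFun.PicardCategory P]
    (H : 𝒯 ⥤ E) [H.IsHomological] (hH : DetFun.IsBounded H) :
    ∃ (hobj : ∀ g : DetFun.GrDet E P, (DetFun.starData H hH g).IsDeterminant)
      (hmap : ∀ {g g' : DetFun.GrDet E P} (l : g ⟶ g'),
        DetFun.TriDetData.IsMorphism (DetFun.starIso H hH l))
      (Hstar : DetFun.GrDet E P ⥤ DetFun.TriDet 𝒯 P),
      Hstar.toPrefunctor =
        { obj := fun g => ⟨DetFun.starData H hH g, hobj g⟩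
          map := fun l => ⟨DetFun.starIso H hH l, hmap l⟩ } :=
  ⟨DetFun.starData_isDeterminant H hH, DetFun.starIso_isMorphism H hH,
    { obj := fun g => ⟨DetFun.starData H hH g, DetFun.starData_isDeterminant H hH g⟩
      map := fun l => ⟨DetFun.starIso H hH l, DetFun.starIso_isMorphism H hH l⟩
      map_id := fun _ => DetFun.TriDet.Hom.ext (Functor.isoWhiskerLeft_refl _ _)
      map_comp := fun _ _ => DetFun.TriDet.Hom.ext (Functor.isoWhiskerLeft_trans _ _ _) }, rfl⟩
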